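/- All Hilbert spaces are finite-dimensional and $\log$ is the base-two logarithm. A linear map $\mathcal{N}:\mathcal{B}(\mathcal{H}_A)\to\mathcal{B}(\mathcal{H}_B)$ is an entanglement-breaking channel if it is trace-preserving and there are finitely many positive semidefinite operators $N_x$ on $\mathcal{H}_B$ and $M_x$ on $\mathcal{H}_A$ with $\mathcal{N}(X)=\sum_x N_x\operatorname{Tr}\{M_xX\}$ for all $X$. For positive semidefinite $A,B$ and $\alpha>1$, the sandwiched R\'enyi relative entropy is \[ \widetilde{D}_\alpha(A\|B)=\frac{1}{\alpha-1}\log \operatorname{Tr}\Big\{\big(B^{\frac{1-\alpha}{2\alpha}}AB^{\frac{1-\alpha}{2\alpha}}\big)^{\alpha}\Big\} \] if $\operatorname{supp}(A)\subseteq\operatorname{supp}(B)$ (powers of $B$ being taken on its support), and $\widetilde{D}_\alpha(A\|B)=\infty$ otherwise. For a channel $\mathcal{N}$, the $\alpha$-Holevo information is \[ \widetilde{\chi}_\alpha(\mathcal{N})=\max_{\{p_X(x),\rho_x\}}\ \min_{\sigma}\ \widetilde{D}_\alpha\big(\rho_{XB}\,\big\|\,\rho_X\otimes\sigma\big),\qquad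 \rho_{XB}=\sum_x p_X(x)\,|x\rangle\langle x|_X\otimes\mathcal{N}(\rho_x),\quad \rho_X=\operatorname{Tr}_B\{\rho_{XB}\}, \] where the maximum is over all finite ensembles of density operators on the input space $\mathcal{H}_A$ and the minimum over all density operators $\sigma$ on the output space $\mathcal{H}_B$ (maximum and minimum being read as supremum and infimum in the extended reals). Let $\mathcal{N}_{\mathrm{EB}}$ be an entanglement-breaking channel. Then for all $\alpha\in(1,2]$ and every positive integer $n$, \[ \widetilde{\chi}_\alpha\big(\mathcal{N}_{\mathrm{EB}}^{\otimes n}\big)\le n\,\widetilde{\chi}_\alpha\big(\mathcal{N}_{\mathrm{EB}}\big). \] -/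

import Mathlib

open scoped Kronecker ComplexOrder

noncomputable section

namespace QChannel

/-- A density operator on the Hilbert space `ℂ^ι`. -/
def DensityMatrix (ι : Type*) [Fintype ι] : Type _ :=
  {ρ : Matrix ι ι ℂ // ρ.PosSemidef ∧ ρ.trace = 1}

/-- The real power `A ^ s` of a positive semidefinite matrix, taken on the support of `A`:
for `s ≠ 0` the eigenvalue `0` is kept at `0` (as `(0 : ℝ) ^ s = 0`), so that negative powers
are those of the generalized inverse. -/
def matPow {ι : Type*} [Fintype ι] [DecidableEq ι] (A : Matrix ι ι ℂ) (s : ℝ) : Matrix ι ι ℂ :=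
  cfc (fun x : ℝ => x ^ s) A

/-- The support of an operator: the orthogonal complement of its kernel. -/
def supp {ι : Type*} [Fintype ι] [DecidableEq ι] (A : Matrix ι ι ℂ) :
    Submodule ℂ (EuclideanSpace ℂ ι) :=
  (LinearMap.ker (Matrix.toEuclideanLin A))ᗮ

open scoped Classical in
/-- The sandwiched quasi-relative entropy `Q̃_α(A‖B)` of positive semidefinite `A`, `B`. -/
def sandwichedQ {ι : Type*} [Fintype ι] [DecidableEq ι] (α : ℝ) (A B : Matrix ι ι ℂ) : ENNReal :=
  if supp A ≤ supp B then
    ENNReal.ofReal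
      (matPow (matPow B ((1 - α) / (2 * α)) * A * matPow B ((1 - α) / (2 * α))) α).trace.re
  else ⊤

/-- The sandwiched Rényi relative entropy `D̃_α(A‖B) = (α - 1)⁻¹ log₂ Q̃_α(A‖B)`, an extended
real number (`ENNReal.log` is the natural logarithm). -/
def sandwichedD {ι : Type*} [Fintype ι] [DecidableEq ι] (α : ℝ) (A B : Matrix ι ι ℂ) : EReal :=
  ((1 / ((α - 1) * Real.log 2) : ℝ) : EReal) * ENNReal.log (sandwichedQ α A B)

/-- A finite ensemble `{p_X(x), ρ_x}` of density operators. -/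
structure Ensemble (ι : Type*) [Fintype ι] where
  size : ℕ
  prob : Fin size → ℝ
  prob_nonneg : ∀ x, 0 ≤ prob x
  prob_sum : ∑ x, prob x = 1
  state : Fin size → DensityMatrix ι

/-- The classical-quantum operator `∑ x, p(x) |x⟩⟨x| ⊗ ρ_x`. -/
def cqState {ι : Type*} {k : ℕ} (p : Fin k → ℝ) (ρ : Fin k → Matrix ι ι ℂ) :
    Matrix (Fin k × ι) (Fin k × ι) ℂ :=
  ∑ x, (p x : ℂ) • (Matrix.single x x (1 : ℂ) ⊗ₖ ρ x)

/-- The partial trace over the second tensor factor. -/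
def ptraceRight {κ ι : Type*} [Fintype ι] (M : Matrix (κ × ι) (κ × ι) ℂ) : Matrix κ κ ℂ :=
  Matrix.of fun i j => ∑ q, M (i, q) (j, q)

/-- `χ̃_α({p(x), ρ_x}) = min_σ D̃_α(ρ_XQ ‖ ρ_X ⊗ σ_Q)`, over density operators `σ`. -/
def ensembleHolevo {ι : Type*} [Fintype ι] [DecidableEq ι] (α : ℝ) {k : ℕ}
    (p : Fin k → ℝ) (ρ : Fin k → Matrix ι ι ℂ) : EReal :=
  ⨅ σ : DensityMatrix ι, sandwichedD α (cqState p ρ) (ptraceRight (cqState p ρ) ⊗ₖ σ.1)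

/-- The `α`-Holevo information `χ̃_α(N)` of a map `N`, the maximum of
`χ̃_α({p(x), N(ρ_x)})` over the ensembles on the input space. -/
def holevoInfo {A B : Type*} [Fintype A] [Fintype B] [DecidableEq B] (α : ℝ)
    (N : Matrix A A ℂ →ₗ[ℂ] Matrix B B ℂ) : EReal :=
  ⨆ E : Ensemble A, ensembleHolevo α E.prob fun x => N (E.state x).1

/-- A linear map of the form `X ↦ ∑ x, Tr(M_x X) N_x` with all `M_x` and `N_x` positive
semidefinite. -/
def IsEntanglementBreaking {A B : Type*} [Fintype A]
    (N : Matrix A A ℂ →ₗ[ℂ] Matrix B B ℂ) : Prop :=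
  ∃ (k : ℕ) (R : Fin k → Matrix B B ℂ) (M : Fin k → Matrix A A ℂ),
    (∀ x, (R x).PosSemidef) ∧ (∀ x, (M x).PosSemidef) ∧
      ∀ X, N X = ∑ x, (M x * X).trace • R x

def IsTracePreserving {A B : Type*} [Fintype A] [Fintype B]
    (N : Matrix A A ℂ →ₗ[ℂ] Matrix B B ℂ) : Prop :=
  ∀ X, (N X).trace = X.trace

/-- An entanglement-breaking channel is a trace-preserving entanglement-breaking map (the form
required in `IsEntanglementBreaking` makes it completely positive). -/
def IsEntanglementBreakingChannel {A B : Type*} [Fintype A] [Fintype B]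
    (N : Matrix A A ℂ →ₗ[ℂ] Matrix B B ℂ) : Prop :=
  IsEntanglementBreaking N ∧ IsTracePreserving N

/-- The tensor power `N^{⊗n}`, acting on matrices indexed by `Fin n → A`, that is, on operators
on `(ℂ^A)^{⊗n}`. It sends the matrix unit `⊗ᵢ |aᵢ⟩⟨a'ᵢ|` to `⊗ᵢ N(|aᵢ⟩⟨a'ᵢ|)`. -/
def tensorPower {A B : Type*} [Fintype A] [DecidableEq A]
    (N : Matrix A A ℂ →ₗ[ℂ] Matrix B B ℂ) (n : ℕ) :
    Matrix (Fin n → A) (Fin n → A) ℂ →ₗ[ℂ] Matrix (Fin n → B) (Fin n → B) ℂ where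
  toFun X := Matrix.of fun b b' =>
    ∑ a, ∑ a', X a a' * ∏ i, N (Matrix.single (a i) (a' i) 1) (b i) (b' i)
  map_add' X Y := by
    ext b b'
    simp [add_mul, Finset.sum_add_distrib]
  map_smul' c X := by
    ext b b'
    simp [Finset.mul_sum, mul_assoc]

/-- `N^{⊗n}` acts on product operators `⊗ᵢ Xᵢ` factor by factor. -/
theorem tensorPower_apply_prod {A B : Type*} [Fintype A] [DecidableEq A]
    (N : Matrix A A ℂ →ₗ[ℂ] Matrix B B ℂ) (n : ℕ) (X : Fin n → Matrix A A ℂ) :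
    tensorPower N n (Matrix.of fun a a' => ∏ i, X i (a i) (a' i)) =
      Matrix.of fun b b' => ∏ i, N (X i) (b i) (b' i) := by
  ext b b'
  have h : ∀ i, N (X i) (b i) (b' i) =
      ∑ a, ∑ a', X i a a' * N (Matrix.single a a' 1) (b i) (b' i) := by
    intro i
    conv_lhs => rw [Matrix.matrix_eq_sum_single (X i)]
    simp only [map_sum, Matrix.sum_apply]
    refine Finset.sum_congr rfl fun a _ => Finset.sum_congr rfl fun a' _ => ?_
    rw [← mul_one (X i a a'), ← smul_eq_mul, ← Matrix.smul_single, map_smul]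
    simp
  simp only [tensorPower, LinearMap.coe_mk, AddHom.coe_mk, Matrix.of_apply, h,
    Finset.prod_univ_sum, Fintype.piFinset_univ, Finset.prod_mul_distrib]

end QChannel

end

set_option linter.unusedSectionVars false

namespace QChannel

open Matrix

/-! ### Comparison of `matPow` with the C*-algebraic real power -/

section Spectral

open scoped MatrixOrder Matrix.Norms.L2Operator

variable {ι κ : Type*} [Fintype ι] [DecidableEq ι] [Fintype κ] [DecidableEq κ]

/-! Write Q(ω, σ) = Tr (σ^((1-α)/2α) ω σ^((1-α)/2α))^α (`sandwichTr`). For a classical-quantum state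
everything is block diagonal, and the quasi-entropy relative to ρ_X ⊗ σ is the average ∑ p(x)
Q(N(ρ_x), σ) (`sandwichedQ_cqState`). It is affine in the ensemble weights and convex in σ
(`sandwichTr_convex`), so Sion's theorem exchanges the supremum over ensembles with the infimum over
σ: for any v above the single-copy value, one state σ satisfies Q(N(ρ), σ) ≤ v for all inputs ρ at
once (`exists_state_of_ensemble_bound`). Negative powers of σ are badly behaved at singular states,
so the minimax is run on states σ ≥ δ·1; mixing with the identity costs only a factor close to one
(`sandwichTr_mix_le`).

For fixed σ, the map X ↦ τ N(X) τ with τ = σ^((1-α)/2α) is still of measure-and-prepare form. King's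
argument makes its bound on Tr(·)^α multiplicative (`trPow_tensorPower_le`), so σ^{⊗n} certifies v^n
for every n-copy ensemble. Letting v decrease to the single-copy value gives the theorem.

King's argument peels off one factor: the output is ∑ R_x ⊗ G_x, with G_x the n-fold output on the
unnormalised state left by outcome x, of trace t_x. The core is Tr(∑ R_x ⊗ G_x)^p ≤ C Tr(∑ t_x
R_x)^p whenever Tr G_x^p ≤ C t_x^p (`trPow_sum_kronecker_le`). It rests on an operator Hölder
inequality (`contractRight_matPow_le`), itself a consequence of operator concavity of t^r for r =
(p-1)/p. -/

theorem matPow_eq_rpow {A : Matrix ι ι ℂ} (hA : A.PosSemidef) (s : ℝ) : matPow A s = A ^ s := by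
  rw [CFC.rpow_eq_cfc_real (Matrix.nonneg_iff_posSemidef.2 hA)]
  rfl

end Spectral

/-! ### Spectral calculus, block diagonal matrices, traces of powers -/

section Basic

variable {ι κ : Type*} [Fintype ι] [DecidableEq ι] [Fintype κ] [DecidableEq κ]

theorem exists_spectral_nonneg {A : Matrix ι ι ℂ} (hA : A.PosSemidef) :
    ∃ U ∈ unitaryGroup ι ℂ, ∃ d : ι → ℝ, (∀ i, 0 ≤ d i) ∧
      A = U * diagonal (fun i => (d i : ℂ)) * Uᴴ :=
  ⟨hA.1.eigenvectorUnitary, hA.1.eigenvectorUnitary.2, hA.1.eigenvalues, hA.eigenvalues_nonneg, by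
    conv_lhs => rw [hA.1.spectral_theorem]
    rfl⟩

theorem unitary_conjTranspose_mul {U : Matrix ι ι ℂ} (hU : U ∈ unitaryGroup ι ℂ) : Uᴴ * U = 1 :=
  mem_unitaryGroup_iff'.1 hU

theorem unitary_mul_conjTranspose {U : Matrix ι ι ℂ} (hU : U ∈ unitaryGroup ι ℂ) : U * Uᴴ = 1 :=
  mem_unitaryGroup_iff.1 hU

theorem isHermitian_conj_diagonal (U : Matrix ι ι ℂ) (d : ι → ℝ) :
    (U * diagonal (fun i => (d i : ℂ)) * Uᴴ).IsHermitian := by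
  refine isHermitian_mul_mul_conjTranspose U ?_
  refine isHermitian_diagonal_of_self_adjoint _ ?_
  ext i
  simp

theorem posSemidef_conj_diagonal (U : Matrix ι ι ℂ) {d : ι → ℝ} (hd : ∀ i, 0 ≤ d i) :
    (U * diagonal (fun i => (d i : ℂ)) * Uᴴ).PosSemidef :=
  (PosSemidef.diagonal fun i => by simpa using hd i).mul_mul_conjTranspose_same U

theorem cfc_conj_diagonal {U : Matrix ι ι ℂ} (hU : U ∈ unitaryGroup ι ℂ) (f : ℝ → ℝ) (d : ι → ℝ) :
    cfc f (U * diagonal (fun i => (d i : ℂ)) * Uᴴ) =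
      U * diagonal (fun i => (f (d i) : ℂ)) * Uᴴ := by
  -- Interpolating `f` at the eigenvalues reduces the claim to polynomials, which commute with
  -- conjugation and with the diagonal embedding.
  set P := Lagrange.interpolate (Finset.univ.image d) id f with hP
  have hPf : ∀ i, P.eval (d i) = f (d i) := fun i =>
    Lagrange.eval_interpolate_at_node (v := id) f (Function.injective_id.injOn)
      (Finset.mem_image_of_mem d (Finset.mem_univ i))
  have hsa : IsSelfAdjoint (U * diagonal (fun i => (d i : ℂ)) * Uᴴ) := isHermitian_conj_diagonal U d
  have hconj : ∀ X : Matrix ι ι ℂ, U * X * Uᴴ = Unitary.conjStarAlgAut ℝ _ ⟨U, hU⟩ X :=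
    fun X => rfl
  have h1 : cfc f (U * diagonal (fun i => (d i : ℂ)) * Uᴴ) =
      cfc P.eval (U * diagonal (fun i => (d i : ℂ)) * Uᴴ) := by
    refine cfc_congr fun x hx => ?_
    rw [hconj, Unitary.conjStarAlgAut_apply, Unitary.spectrum_star_right_conjugate] at hx
    have hx' := spectrum.algebraMap_mem ℂ hx
    rw [spectrum_diagonal] at hx'
    obtain ⟨i, hi⟩ := hx'
    have : d i = x := by simpa using hi
    rw [← this, hPf]
  have h2 : ∀ D : ι → ℂ, Polynomial.aeval (diagonal D : Matrix ι ι ℂ) P =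
      (diagonal fun i => (Polynomial.aeval (D i) P : ℂ) : Matrix ι ι ℂ) := by
    intro D
    have := Polynomial.aeval_algHom_apply (diagonalAlgHom ℝ (n := ι) (α := ℂ)) D P
    simp only [diagonalAlgHom_apply] at this
    rw [this]
    congr 1
    ext i
    exact (Polynomial.aeval_algHom_apply (Pi.evalAlgHom ℝ (fun _ : ι => ℂ) i) D P).symm
  rw [h1, cfc_polynomial P _ hsa, hconj, hconj]
  have h3 := Polynomial.aeval_algHom_apply
    ((Unitary.conjStarAlgAut ℝ (Matrix ι ι ℂ) ⟨U, hU⟩ : _ ≃⋆ₐ[ℝ] _) : Matrix ι ι ℂ →ₐ[ℝ] Matrix ι ι ℂ)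
    (diagonal fun i => (d i : ℂ)) P
  refine h3.trans ?_
  rw [h2]
  have h4 : (fun i => Polynomial.aeval (d i : ℂ) P) = fun i => (f (d i) : ℂ) := by
    ext i
    rw [← hPf i]
    simpa using Polynomial.aeval_algebraMap_apply ℂ (d i) P
  rw [h4]
  rfl

theorem matPow_conj_diagonal {U : Matrix ι ι ℂ} (hU : U ∈ unitaryGroup ι ℂ) (d : ι → ℝ) (s : ℝ) :
    matPow (U * diagonal (fun i => (d i : ℂ)) * Uᴴ) s =
      U * diagonal (fun i => ((d i ^ s : ℝ) : ℂ)) * Uᴴ :=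
  cfc_conj_diagonal hU _ d

theorem conj_diagonal_mul {U : Matrix ι ι ℂ} (hU : U ∈ unitaryGroup ι ℂ) (c d : ι → ℂ) :
    (U * diagonal c * Uᴴ) * (U * diagonal d * Uᴴ) = U * diagonal (fun i => c i * d i) * Uᴴ := by
  calc _ = U * diagonal c * (Uᴴ * U) * diagonal d * Uᴴ := by simp only [Matrix.mul_assoc]
    _ = _ := by
      rw [unitary_conjTranspose_mul hU, Matrix.mul_one, Matrix.mul_assoc U, diagonal_mul_diagonal]

theorem matPow_posSemidef {A : Matrix ι ι ℂ} (hA : A.PosSemidef) (s : ℝ) :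
    (matPow A s).PosSemidef := by
  obtain ⟨U, hU, d, hd, rfl⟩ := exists_spectral_nonneg hA
  rw [matPow_conj_diagonal hU]
  exact posSemidef_conj_diagonal U fun i => Real.rpow_nonneg (hd i) s

/-- The exponents must not cancel: for s = -t ≠ 0 the product is the support projection, while
`matPow A 0` is the identity because `0 ^ 0 = 1`. -/
theorem matPow_mul_matPow {A : Matrix ι ι ℂ} (hA : A.PosSemidef) {s t : ℝ} (hst : s + t ≠ 0) :
    matPow A s * matPow A t = matPow A (s + t) := by
  obtain ⟨U, hU, d, hd, rfl⟩ := exists_spectral_nonneg hA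
  simp only [matPow_conj_diagonal hU, conj_diagonal_mul hU]
  congr 4
  ext i
  rw [Real.rpow_add' (hd i) hst]
  simp

theorem matPow_matPow {A : Matrix ι ι ℂ} (hA : A.PosSemidef) (s t : ℝ) :
    matPow (matPow A s) t = matPow A (s * t) := by
  obtain ⟨U, hU, d, hd, rfl⟩ := exists_spectral_nonneg hA
  simp only [matPow_conj_diagonal hU]
  congr 4
  ext i
  rw [Real.rpow_mul (hd i)]

theorem matPow_one {A : Matrix ι ι ℂ} (hA : A.PosSemidef) : matPow A 1 = A := by
  obtain ⟨U, hU, d, hd, rfl⟩ := exists_spectral_nonneg hA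
  simp [matPow_conj_diagonal hU]

theorem matPow_smul {A : Matrix ι ι ℂ} (hA : A.PosSemidef) {c : ℝ} (hc : 0 ≤ c) (s : ℝ) :
    matPow ((c : ℂ) • A) s = ((c ^ s : ℝ) : ℂ) • matPow A s := by
  obtain ⟨U, hU, d, hd, rfl⟩ := exists_spectral_nonneg hA
  have h : (c : ℂ) • (U * diagonal (fun i => (d i : ℂ)) * Uᴴ) =
      U * diagonal (fun i => ((c * d i : ℝ) : ℂ)) * Uᴴ := by
    rw [← Matrix.smul_mul, ← Matrix.mul_smul, ← diagonal_smul]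
    congr 3
    ext i
    simp
  rw [h]
  simp only [matPow_conj_diagonal hU]
  rw [← Matrix.smul_mul, ← Matrix.mul_smul, ← diagonal_smul]
  congr 3
  ext i
  simp [Real.mul_rpow hc (hd i)]

theorem matPow_unitary_conj {V A : Matrix ι ι ℂ} (hV : V ∈ unitaryGroup ι ℂ) (hA : A.PosSemidef)
    (s : ℝ) : matPow (V * A * Vᴴ) s = V * matPow A s * Vᴴ := by
  obtain ⟨U, hU, d, hd, rfl⟩ := exists_spectral_nonneg hA
  have h : ∀ D : Matrix ι ι ℂ, V * (U * D * Uᴴ) * Vᴴ = (V * U) * D * (V * U)ᴴ := by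
    intro D
    simp only [conjTranspose_mul, Matrix.mul_assoc]
  rw [h, matPow_conj_diagonal (mul_mem hV hU), matPow_conj_diagonal hU, h]

theorem matPow_submatrix_equiv {A : Matrix ι ι ℂ} (hA : A.PosSemidef) (e : κ ≃ ι) (s : ℝ) :
    matPow (A.submatrix e e) s = (matPow A s).submatrix e e := by
  obtain ⟨U, hU, d, hd, rfl⟩ := exists_spectral_nonneg hA
  have h : ∀ c : ι → ℝ, (U * diagonal (fun i => (c i : ℂ)) * Uᴴ).submatrix e e =
      U.submatrix e e * diagonal (fun i => (c (e i) : ℂ)) * (U.submatrix e e)ᴴ := by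
    intro c
    rw [← submatrix_mul_equiv _ _ e e e, ← submatrix_mul_equiv _ _ e e e,
      submatrix_diagonal_equiv, conjTranspose_submatrix]
    rfl
  have hU' : U.submatrix e e ∈ unitaryGroup κ ℂ := by
    rw [mem_unitaryGroup_iff, star_eq_conjTranspose, conjTranspose_submatrix,
      submatrix_mul_equiv, unitary_mul_conjTranspose hU, submatrix_one_equiv]
  rw [h, matPow_conj_diagonal hU', matPow_conj_diagonal hU, h]

theorem matPow_fromBlocks {A : Matrix ι ι ℂ} {B : Matrix κ κ ℂ} (hA : A.PosSemidef)
    (hB : B.PosSemidef) (s : ℝ) :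
    matPow (fromBlocks A 0 0 B) s = fromBlocks (matPow A s) 0 0 (matPow B s) := by
  obtain ⟨U, hU, d, hd, rfl⟩ := exists_spectral_nonneg hA
  obtain ⟨V, hV, c, hc, rfl⟩ := exists_spectral_nonneg hB
  have h : ∀ (x : ι → ℝ) (y : κ → ℝ), fromBlocks (U * diagonal (fun i => (x i : ℂ)) * Uᴴ) 0 0
      (V * diagonal (fun i => (y i : ℂ)) * Vᴴ) =
      (fromBlocks U 0 0 V) * diagonal (fun i => ((Sum.elim x y i : ℝ) : ℂ)) *
        (fromBlocks U 0 0 V)ᴴ := by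
    intro x y
    have : (diagonal fun i => ((Sum.elim x y i : ℝ) : ℂ)) =
        fromBlocks (diagonal fun i => (x i : ℂ)) 0 0 (diagonal fun i => (y i : ℂ)) := by
      rw [fromBlocks_diagonal]
      congr 1
      ext i
      cases i <;> rfl
    rw [this, fromBlocks_conjTranspose, fromBlocks_multiply, fromBlocks_multiply]
    simp
  have hUV : fromBlocks U 0 0 V ∈ unitaryGroup (ι ⊕ κ) ℂ := by
    rw [mem_unitaryGroup_iff, star_eq_conjTranspose, fromBlocks_conjTranspose, fromBlocks_multiply]
    simp [unitary_mul_conjTranspose hU, unitary_mul_conjTranspose hV]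
  rw [h, matPow_conj_diagonal hUV, matPow_conj_diagonal hU, matPow_conj_diagonal hV, h]
  congr 4
  ext i
  cases i <;> rfl

/-- The block diagonal matrix with blocks indexed by the first tensor factor. -/
def ctrlBlock (M : κ → Matrix ι ι ℂ) : Matrix (κ × ι) (κ × ι) ℂ :=
  Matrix.of fun a b => if a.1 = b.1 then M a.1 a.2 b.2 else 0

theorem ctrlBlock_mul (M N : κ → Matrix ι ι ℂ) :
    ctrlBlock M * ctrlBlock N = ctrlBlock fun x => M x * N x := by
  ext ⟨x, i⟩ ⟨y, j⟩
  simp only [mul_apply, ctrlBlock, of_apply, Fintype.sum_prod_type, ite_mul, zero_mul, mul_ite,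
    mul_zero]
  rw [Finset.sum_eq_single x (fun z _ hz => by simp [Ne.symm hz]) (by simp)]
  by_cases h : x = y <;> simp [h]

theorem ctrlBlock_conjTranspose (M : κ → Matrix ι ι ℂ) :
    (ctrlBlock M)ᴴ = ctrlBlock fun x => (M x)ᴴ := by
  ext ⟨x, i⟩ ⟨y, j⟩
  simp only [conjTranspose_apply, ctrlBlock, of_apply]
  by_cases h : x = y
  · simp [h]
  · simp [h, Ne.symm h]

theorem ctrlBlock_one : ctrlBlock (fun _ : κ => (1 : Matrix ι ι ℂ)) = 1 := by
  ext ⟨x, i⟩ ⟨y, j⟩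
  by_cases h : x = y <;> simp [ctrlBlock, h, one_apply]

theorem ctrlBlock_diagonal (d : κ → ι → ℂ) :
    ctrlBlock (fun x => diagonal (d x)) = diagonal fun a => d a.1 a.2 := by
  ext ⟨x, i⟩ ⟨y, j⟩
  by_cases h : x = y <;> simp [ctrlBlock, h, diagonal_apply]

theorem trace_ctrlBlock (M : κ → Matrix ι ι ℂ) : (ctrlBlock M).trace = ∑ x, (M x).trace := by
  simp [trace, ctrlBlock, Fintype.sum_prod_type]

theorem matPow_ctrlBlock {M : κ → Matrix ι ι ℂ} (hM : ∀ x, (M x).PosSemidef) (s : ℝ) :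
    matPow (ctrlBlock M) s = ctrlBlock fun x => matPow (M x) s := by
  choose U hU d hd hMd using fun x => exists_spectral_nonneg (hM x)
  have h : ∀ c : κ → ι → ℝ, (ctrlBlock fun x => U x * diagonal (fun i => (c x i : ℂ)) * (U x)ᴴ) =
      ctrlBlock U * diagonal (fun a => (c a.1 a.2 : ℂ)) * (ctrlBlock U)ᴴ := by
    intro c
    rw [ctrlBlock_conjTranspose, ← ctrlBlock_diagonal fun x i => (c x i : ℂ), ctrlBlock_mul,
      ctrlBlock_mul]
  have hU' : ctrlBlock U ∈ unitaryGroup (κ × ι) ℂ := by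
    rw [mem_unitaryGroup_iff, star_eq_conjTranspose, ctrlBlock_conjTranspose, ctrlBlock_mul]
    simp only [unitary_mul_conjTranspose (hU _), ctrlBlock_one]
  have h1 : M = fun x => U x * diagonal (fun i => (d x i : ℂ)) * (U x)ᴴ := funext hMd
  rw [h1, h, matPow_conj_diagonal hU']
  simp only [matPow_conj_diagonal (hU _)]
  rw [h]

/-- `Tr A ^ p`, as a real number. -/
noncomputable def trPow (p : ℝ) (A : Matrix ι ι ℂ) : ℝ := (matPow A p).trace.re

theorem trace_conj_diagonal {U : Matrix ι ι ℂ} (hU : U ∈ unitaryGroup ι ℂ) (d : ι → ℂ) :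
    (U * diagonal d * Uᴴ).trace = ∑ i, d i := by
  rw [trace_mul_comm, ← Matrix.mul_assoc, unitary_conjTranspose_mul hU, Matrix.one_mul,
    trace_diagonal]

theorem trPow_conj_diagonal {U : Matrix ι ι ℂ} (hU : U ∈ unitaryGroup ι ℂ) (d : ι → ℝ) (p : ℝ) :
    trPow p (U * diagonal (fun i => (d i : ℂ)) * Uᴴ) = ∑ i, d i ^ p := by
  rw [trPow, matPow_conj_diagonal hU, trace_conj_diagonal hU]
  simp

theorem trPow_nonneg {A : Matrix ι ι ℂ} (hA : A.PosSemidef) (p : ℝ) : 0 ≤ trPow p A :=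
  (Complex.nonneg_iff.1 (matPow_posSemidef hA p).trace_nonneg).1

theorem trPow_smul {A : Matrix ι ι ℂ} (hA : A.PosSemidef) {c : ℝ} (hc : 0 ≤ c) (p : ℝ) :
    trPow p ((c : ℂ) • A) = c ^ p * trPow p A := by
  rw [trPow, matPow_smul hA hc, trace_smul, smul_eq_mul, Complex.re_ofReal_mul, trPow]

theorem trPow_submatrix_equiv {A : Matrix ι ι ℂ} (hA : A.PosSemidef) (e : κ ≃ ι) (p : ℝ) :
    trPow p (A.submatrix e e) = trPow p A := by
  rw [trPow, matPow_submatrix_equiv hA, trPow]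
  congr 1
  exact Equiv.sum_comp e fun i => matPow A p i i

theorem trPow_ctrlBlock {M : κ → Matrix ι ι ℂ} (hM : ∀ x, (M x).PosSemidef) (p : ℝ) :
    trPow p (ctrlBlock M) = ∑ x, trPow p (M x) := by
  simp [trPow, matPow_ctrlBlock hM, trace_ctrlBlock]

theorem trPow_eq_sum_roots {A : Matrix ι ι ℂ} (hA : A.IsHermitian) (p : ℝ) :
    trPow p A = (A.charpoly.roots.map fun z => z.re ^ p).sum := by
  rw [hA.roots_charpoly_eq_eigenvalues]
  conv_lhs => rw [hA.spectral_theorem]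
  refine (trPow_conj_diagonal hA.eigenvectorUnitary.2 hA.eigenvalues p).trans ?_
  simp

/-- The two products have the same characteristic polynomial, and `trPow` is a sum over its roots.
-/
theorem trPow_conjTranspose_mul_self (X : Matrix ι ι ℂ) (p : ℝ) :
    trPow p (Xᴴ * X) = trPow p (X * Xᴴ) := by
  rw [trPow_eq_sum_roots (isHermitian_conjTranspose_mul_self X),
    trPow_eq_sum_roots (isHermitian_mul_conjTranspose_self X), charpoly_mul_comm]

theorem trace_mul_nonneg {A B : Matrix ι ι ℂ} (hA : A.PosSemidef) (hB : B.PosSemidef) :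
    0 ≤ (A * B).trace := by
  obtain ⟨U, hU, d, hd, rfl⟩ := exists_spectral_nonneg hA
  have h : (U * diagonal (fun i => (d i : ℂ)) * Uᴴ * B).trace =
      (diagonal (fun i => (d i : ℂ)) * (Uᴴ * B * U)).trace := by
    rw [Matrix.mul_assoc, Matrix.mul_assoc, trace_mul_comm]
    simp only [Matrix.mul_assoc]
  rw [h, trace]
  refine Finset.sum_nonneg fun i _ => ?_
  rw [diag_apply, diagonal_mul]
  exact mul_nonneg (by simpa using hd i) (hB.conjTranspose_mul_mul_same U).diag_nonneg

theorem trace_mul_mono {A B C : Matrix ι ι ℂ} (hAB : (B - A).PosSemidef) (hC : C.PosSemidef) :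
    (A * C).trace.re ≤ (B * C).trace.re := by
  have h := (Complex.nonneg_iff.1 (trace_mul_nonneg hAB hC)).1
  rw [Matrix.sub_mul, trace_sub, Complex.sub_re] at h
  linarith

end Basic

/-! ### Trace Young inequality; convexity and monotonicity of Tr X^p -/

section Young

variable {ι κ : Type*} [Fintype ι] [DecidableEq ι] [Fintype κ] [DecidableEq κ]

theorem sum_normSq_row {W : Matrix ι ι ℂ} (hW : W ∈ unitaryGroup ι ℂ) (i : ι) :
    ∑ j, Complex.normSq (W i j) = 1 := by
  have h := congrFun (congrFun (unitary_mul_conjTranspose hW) i) i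
  simp only [mul_apply, conjTranspose_apply, one_apply_eq, RCLike.star_def, Complex.mul_conj] at h
  exact_mod_cast h

theorem sum_normSq_col {W : Matrix ι ι ℂ} (hW : W ∈ unitaryGroup ι ℂ) (j : ι) :
    ∑ i, Complex.normSq (W i j) = 1 := by
  have h := congrFun (congrFun (unitary_conjTranspose_mul hW) j) j
  simp only [mul_apply, conjTranspose_apply, one_apply_eq, RCLike.star_def,
    ← Complex.normSq_eq_conj_mul_self] at h
  exact_mod_cast h

/-- Young's inequality for traces. -/
theorem trace_mul_le_young {p q : ℝ} (hpq : p.HolderConjugate q) {X Z : Matrix ι ι ℂ}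
    (hX : X.PosSemidef) (hZ : Z.PosSemidef) :
    (X * Z).trace.re ≤ trPow p X / p + trPow q Z / q := by
  obtain ⟨U, hU, x, hx, rfl⟩ := exists_spectral_nonneg hX
  obtain ⟨V, hV, z, hz, rfl⟩ := exists_spectral_nonneg hZ
  rw [trPow_conj_diagonal hU, trPow_conj_diagonal hV]
  -- The numbers |W i j|² form a doubly stochastic matrix, so the trace inequality is an average of
  -- scalar Young inequalities.
  set W := Uᴴ * V with hWdef
  have hW : W ∈ unitaryGroup ι ℂ := by
    rw [mem_unitaryGroup_iff', star_eq_conjTranspose, hWdef, conjTranspose_mul,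
      conjTranspose_conjTranspose, Matrix.mul_assoc, ← Matrix.mul_assoc U,
      unitary_mul_conjTranspose hU, Matrix.one_mul, unitary_conjTranspose_mul hV]
  have h1 : ((U * diagonal (fun i => (x i : ℂ)) * Uᴴ) *
      (V * diagonal (fun i => (z i : ℂ)) * Vᴴ)).trace.re =
      ∑ i, ∑ j, x i * z j * Complex.normSq (W i j) := by
    have : ((U * diagonal (fun i => (x i : ℂ)) * Uᴴ) *
        (V * diagonal (fun i => (z i : ℂ)) * Vᴴ)).trace =
        (diagonal (fun i => (x i : ℂ)) * W * (diagonal (fun i => (z i : ℂ)) * Wᴴ)).trace := by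
      simp only [Matrix.mul_assoc]
      rw [trace_mul_comm]
      simp only [hWdef, conjTranspose_mul, conjTranspose_conjTranspose, Matrix.mul_assoc]
    rw [this, trace, Complex.re_sum]
    refine Finset.sum_congr rfl fun i _ => ?_
    rw [diag_apply, mul_apply, Complex.re_sum]
    refine Finset.sum_congr rfl fun j _ => ?_
    rw [diagonal_mul, diagonal_mul, conjTranspose_apply]
    have h2 : (x i : ℂ) * W i j * ((z j : ℂ) * star (W i j)) =
        ((x i * z j * Complex.normSq (W i j) : ℝ) : ℂ) := by
      push_cast
      rw [← Complex.mul_conj]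
      simp only [RCLike.star_def]
      ring
    rw [h2, Complex.ofReal_re]
  rw [h1]
  calc ∑ i, ∑ j, x i * z j * Complex.normSq (W i j)
      ≤ ∑ i, ∑ j, (x i ^ p / p * Complex.normSq (W i j) + z j ^ q / q * Complex.normSq (W i j)) := by
        refine Finset.sum_le_sum fun i _ => Finset.sum_le_sum fun j _ => ?_
        rw [← add_mul]
        exact mul_le_mul_of_nonneg_right
          (Real.young_inequality_of_nonneg (hx i) (hz j) hpq) (Complex.normSq_nonneg _)
    _ = _ := by
        simp only [Finset.sum_add_distrib]
        congr 1
        · simp only [← Finset.mul_sum, sum_normSq_row hW, mul_one, Finset.sum_div]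
        · rw [Finset.sum_comm]
          simp only [← Finset.mul_sum, sum_normSq_col hW, mul_one, Finset.sum_div]

/-- Duality by absorption: X^(p-1) is the optimal test operator for X, with Tr X X^(p-1) = Tr X^p,
so the term of weight (p-1)/p moves to the left and leaves weight 1/p on both sides. -/
theorem trPow_le_of_trace_mul_le {p : ℝ} (hp : 1 < p) {X : Matrix ι ι ℂ} (hX : X.PosSemidef)
    {c : ℝ} (h : (X * matPow X (p - 1)).trace.re ≤ c / p + trPow p X * ((p - 1) / p)) :
    trPow p X ≤ c := by
  have hp0 : 0 < p := by linarith
  have h1 : X * matPow X (p - 1) = matPow X p := by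
    conv_lhs => enter [1]; rw [← matPow_one hX]
    rw [matPow_mul_matPow hX (by linarith : (1 : ℝ) + (p - 1) ≠ 0)]
    congr 1
    ring
  rw [h1] at h
  change trPow p X ≤ _ at h
  have h2 : trPow p X * ((p - 1) / p) = trPow p X - trPow p X / p := by
    field_simp
  rw [h2] at h
  have h3 : trPow p X / p ≤ c / p := by linarith
  exact (div_le_div_iff_of_pos_right hp0).1 h3

/-- Pair the operator inequality with X^(p-1), apply Young to `Y` and `Z` separately, and absorb:
for the conjugate exponent q, Tr (X^(p-1))^q = Tr X^p. Convexity and monotonicity are obtained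
together. -/
theorem trPow_convex_mono {p : ℝ} (hp : 1 < p) {X Y Z : Matrix ι ι ℂ} (hX : X.PosSemidef)
    (hY : Y.PosSemidef) (hZ : Z.PosSemidef) {a b : ℝ} (ha : 0 ≤ a) (hb : 0 ≤ b) (hab : a + b = 1)
    (h : ((a : ℂ) • Y + (b : ℂ) • Z - X).PosSemidef) :
    trPow p X ≤ a * trPow p Y + b * trPow p Z := by
  have hp0 : 0 < p := by linarith
  have hpq := Real.HolderConjugate.conjExponent hp
  have hM := matPow_posSemidef hX (p - 1)
  have hq : trPow (Real.conjExponent p) (matPow X (p - 1)) = trPow p X := by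
    rw [trPow, matPow_matPow hX, trPow, Real.conjExponent]
    congr 3
    field_simp [(by linarith : p - 1 ≠ 0)]
  have hqi : trPow p X / Real.conjExponent p = trPow p X * ((p - 1) / p) := by
    rw [Real.conjExponent]
    field_simp
  refine trPow_le_of_trace_mul_le hp hX ?_
  refine (trace_mul_mono h hM).trans ?_
  rw [Matrix.add_mul, Matrix.smul_mul, Matrix.smul_mul, trace_add, trace_smul, trace_smul,
    Complex.add_re, smul_eq_mul, smul_eq_mul, Complex.re_ofReal_mul, Complex.re_ofReal_mul]
  have h1 := mul_le_mul_of_nonneg_left (trace_mul_le_young hpq hY hM) ha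
  have h2 := mul_le_mul_of_nonneg_left (trace_mul_le_young hpq hZ hM) hb
  rw [hq, hqi] at h1 h2
  refine (add_le_add h1 h2).trans (le_of_eq ?_)
  have hb' : b = 1 - a := by linarith
  rw [hb']
  ring

theorem trPow_mono {p : ℝ} (hp : 1 < p) {X Y : Matrix ι ι ℂ} (hX : X.PosSemidef)
    (hY : Y.PosSemidef) (h : (Y - X).PosSemidef) : trPow p X ≤ trPow p Y := by
  simpa using trPow_convex_mono hp hX hY hY zero_le_one le_rfl (add_zero 1) (by simpa using h)

end Young

/-! ### Operator Jensen and Hölder inequalities for t^r, 0 ≤ r ≤ 1 -/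

section Jensen

open scoped MatrixOrder Matrix.Norms.L2Operator

variable {ι κ : Type*} [Fintype ι] [DecidableEq ι] [Fintype κ] [DecidableEq κ]

theorem posSemidef_toBlocks₁₁ {M : Matrix (ι ⊕ κ) (ι ⊕ κ) ℂ} (hM : M.PosSemidef) :
    M.toBlocks₁₁.PosSemidef := hM.submatrix Sum.inl

theorem exists_eq_conjTranspose_mul_self {A : Matrix ι ι ℂ} (hA : A.PosSemidef) :
    ∃ X, A = Xᴴ * X := by
  refine ⟨matPow A (1 / 2), ?_⟩
  rw [(matPow_posSemidef hA _).1, matPow_mul_matPow hA (by norm_num)]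
  norm_num [matPow_one hA]

theorem posSemidef_fromBlocks_diag {A : Matrix ι ι ℂ} {B : Matrix κ κ ℂ} (hA : A.PosSemidef)
    (hB : B.PosSemidef) : (fromBlocks A 0 0 B).PosSemidef := by
  obtain ⟨X, rfl⟩ := exists_eq_conjTranspose_mul_self hA
  obtain ⟨Y, rfl⟩ := exists_eq_conjTranspose_mul_self hB
  have : fromBlocks (Xᴴ * X) 0 0 (Yᴴ * Y) = (fromBlocks X 0 0 Y)ᴴ * fromBlocks X 0 0 Y := by
    rw [fromBlocks_conjTranspose, fromBlocks_multiply]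
    simp
  rw [this]
  exact posSemidef_conjTranspose_mul_self _

/-- Pinching: averaging `M` with its conjugate by diag(1, -1) removes the off-diagonal blocks, and
operator concavity of t^r compares the average of the powers with the power of the average. -/
theorem matPow_toBlocks₁₁_le {M : Matrix (ι ⊕ κ) (ι ⊕ κ) ℂ} (hM : M.PosSemidef) {r : ℝ}
    (hr : r ∈ Set.Icc (0 : ℝ) 1) :
    (matPow M.toBlocks₁₁ r - (matPow M r).toBlocks₁₁).PosSemidef := by
  set V : Matrix (ι ⊕ κ) (ι ⊕ κ) ℂ := fromBlocks 1 0 0 (-1) with hVdef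
  have hVH : Vᴴ = V := by rw [hVdef, fromBlocks_conjTranspose]; simp
  have hV : V ∈ unitaryGroup (ι ⊕ κ) ℂ := by
    rw [mem_unitaryGroup_iff, star_eq_conjTranspose, hVH, hVdef, fromBlocks_multiply]
    simp
  have hM2 : M.toBlocks₂₂.PosSemidef := hM.submatrix Sum.inr
  have hM1 := posSemidef_toBlocks₁₁ hM
  have hVM : (V * M * Vᴴ).PosSemidef := hM.mul_mul_conjTranspose_same V
  have havg : ∀ N : Matrix (ι ⊕ κ) (ι ⊕ κ) ℂ,
      (1 / 2 : ℝ) • N + (1 / 2 : ℝ) • (V * N * Vᴴ) = fromBlocks N.toBlocks₁₁ 0 0 N.toBlocks₂₂ := by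
    intro N
    conv_lhs => rw [← fromBlocks_toBlocks N]
    rw [hVH, hVdef, fromBlocks_multiply, fromBlocks_multiply, fromBlocks_smul, fromBlocks_smul,
      fromBlocks_add]
    simp [← add_smul]
    norm_num
  have h := (CFC.concaveOn_rpow (A := Matrix (ι ⊕ κ) (ι ⊕ κ) ℂ) hr).2
    (Set.mem_Ici.2 hM.nonneg) (Set.mem_Ici.2 hVM.nonneg)
    (by norm_num : (0 : ℝ) ≤ 1 / 2) (by norm_num : (0 : ℝ) ≤ 1 / 2) (by norm_num)
  simp only [] at h
  rw [havg, ← matPow_eq_rpow hM, ← matPow_eq_rpow hVM, ← matPow_eq_rpow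
    (posSemidef_fromBlocks_diag hM1 hM2), matPow_unitary_conj hV hM, havg,
    matPow_fromBlocks hM1 hM2, Matrix.le_iff] at h
  have h' := posSemidef_toBlocks₁₁ h
  convert h' using 1
  ext i j
  simp [toBlocks₁₁]

theorem matPow_submatrix_le {M : Matrix κ κ ℂ} (hM : M.PosSemidef) {r : ℝ}
    (hr : r ∈ Set.Icc (0 : ℝ) 1) {f : ι → κ} (hf : Function.Injective f) :
    (matPow (M.submatrix f f) r - (matPow M r).submatrix f f).PosSemidef := by
  classical
  let e : ι ⊕ ↑(Set.range f)ᶜ ≃ κ :=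
    (Equiv.sumCongr (Equiv.ofInjective f hf) (Equiv.refl _)).trans (Equiv.Set.sumCompl _)
  have he : ∀ i, e (Sum.inl i) = f i := fun i => rfl
  have h := matPow_toBlocks₁₁_le (hM.submatrix e) hr
  rw [matPow_submatrix_equiv hM] at h
  exact h

/-- Operator Jensen with weights μ_i = l_i^p / ∑ l^p at the points w_i / μ_i. The weights are tuned
so that μ_i · μ_i^(-r) = μ_i^(1/p), which is l_i divided by the ℓ^p norm of `l`. -/
theorem sum_smul_matPow_le {n : Type*} [Fintype n] {p r : ℝ} (hp : 1 < p) (hr : r = (p - 1) / p)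
    {w : n → Matrix ι ι ℂ} (hw : ∀ i, (w i).PosSemidef) {l : n → ℝ} (hl : ∀ i, 0 ≤ l i) :
    ((((∑ i, l i ^ p) ^ (1 / p) : ℝ) : ℂ) • matPow (∑ i, w i) r -
      ∑ i, (l i : ℂ) • matPow (w i) r).PosSemidef := by
  have hp0 : 0 < p := by linarith
  have hr0 : 0 < r := by rw [hr]; exact div_pos (by linarith) hp0
  have hr1 : r < 1 := by rw [hr, div_lt_one hp0]; linarith
  have hr' : r ∈ Set.Icc (0 : ℝ) 1 := ⟨hr0.le, hr1.le⟩
  set S := ∑ i, l i ^ p with hS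
  have hlp : ∀ i, 0 ≤ l i ^ p := fun i => Real.rpow_nonneg (hl i) p
  have hS0 : 0 ≤ S := Finset.sum_nonneg fun i _ => hlp i
  have hsum : (∑ i, w i).PosSemidef := posSemidef_sum _ fun i _ => hw i
  rcases hS0.eq_or_lt with hS0 | hS0
  · have h0 : ∀ i, l i = 0 := by
      intro i
      have := (Finset.sum_eq_zero_iff_of_nonneg fun i _ => hlp i).1 hS0.symm i (Finset.mem_univ i)
      exact ((Real.rpow_eq_zero_iff_of_nonneg (hl i)).1 this).1
    have : (S : ℝ) ^ (1 / p) = 0 := by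
      rw [← hS0, Real.zero_rpow (by positivity)]
    simp only [this, h0, Complex.ofReal_zero, zero_smul, Finset.sum_const_zero, sub_zero]
    exact PosSemidef.zero
  set c := S ^ (1 / p) with hc
  have hc0 : 0 < c := Real.rpow_pos_of_pos hS0 _
  have hcp : c ^ p = S := by
    rw [hc, ← Real.rpow_mul hS0.le, one_div_mul_cancel hp0.ne', Real.rpow_one]
  set μ : n → ℝ := fun i => l i ^ p / S with hμ
  have hμ0 : ∀ i, 0 ≤ μ i := fun i => div_nonneg (hlp i) hS0.le
  have hμ1 : ∑ i, μ i = 1 := by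
    rw [hμ, ← Finset.sum_div, ← hS, div_self hS0.ne']
  have hv : ∀ i, (((μ i)⁻¹ : ℝ) : ℂ) • w i = (μ i)⁻¹ • w i := fun i => by
    ext a b; simp
  have hvp : ∀ i, ((μ i)⁻¹ • w i).PosSemidef := fun i => by
    rw [← hv]
    exact (hw i).smul (by simpa using hμ0 i)
  have h := (CFC.concaveOn_rpow (A := Matrix ι ι ℂ) hr').le_map_sum (t := Finset.univ)
    (w := μ) (p := fun i => (μ i)⁻¹ • w i) (fun i _ => hμ0 i) hμ1
    (fun i _ => Set.mem_Ici.2 (hvp i).nonneg)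
  -- Only an inequality, since terms with μ_i = 0 vanish on the left; operator monotonicity of t^r
  -- then suffices.
  have h2 : (∑ i, μ i • (μ i)⁻¹ • w i) ≤ ∑ i, w i := by
    refine Finset.sum_le_sum fun i _ => ?_
    by_cases hi : μ i = 0
    · rw [hi]
      simpa using (hw i).nonneg
    · rw [smul_smul, mul_inv_cancel₀ hi, one_smul]
  have h3 := h.trans (CFC.rpow_le_rpow hr' h2)
  have h4 : ∀ i, μ i • ((μ i)⁻¹ • w i) ^ r = ((c⁻¹ * l i : ℝ) : ℂ) • matPow (w i) r := by
    intro i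
    rw [← matPow_eq_rpow (hvp i), ← hv, matPow_smul (hw i) (inv_nonneg.2 (hμ0 i))]
    have h5 : μ i * ((μ i)⁻¹) ^ r = c⁻¹ * l i := by
      have hμc : μ i = (c⁻¹ * l i) ^ p := by
        rw [hμ, Real.mul_rpow (inv_nonneg.2 hc0.le) (hl i), Real.inv_rpow hc0.le, hcp]
        field_simp
      have hx : 0 ≤ c⁻¹ * l i := mul_nonneg (inv_nonneg.2 hc0.le) (hl i)
      rw [hμc]
      generalize c⁻¹ * l i = x at hx
      rcases hx.eq_or_lt with rfl | hx
      · simp [Real.zero_rpow hp0.ne']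
      · rw [← Real.rpow_neg hx.le, ← Real.rpow_mul hx.le, ← Real.rpow_add hx]
        have : p + -p * r = 1 := by rw [hr]; field_simp; ring
        rw [this, Real.rpow_one]
    rw [← h5]
    ext a b
    simp [mul_assoc]
  simp only [h4] at h3
  rw [← matPow_eq_rpow hsum, Matrix.le_iff] at h3
  have h6 := h3.smul (a := (c : ℂ)) (by simpa using hc0.le)
  have h7 : (c : ℂ) • (matPow (∑ i, w i) r - ∑ i, ((c⁻¹ * l i : ℝ) : ℂ) • matPow (w i) r) =
      (c : ℂ) • matPow (∑ i, w i) r - ∑ i, (l i : ℂ) • matPow (w i) r := by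
    rw [smul_sub, Finset.smul_sum]
    congr 1
    refine Finset.sum_congr rfl fun i _ => ?_
    rw [smul_smul, ← Complex.ofReal_mul, mul_inv_cancel_left₀ hc0.ne']
  rw [← h7]
  exact h6

end Jensen

/-! ### King's inequality for sums of tensor products -/

section King

variable {ι κ : Type*} [Fintype ι] [DecidableEq ι] [Fintype κ] [DecidableEq κ]

/-- The partial trace `Tr_κ ((1 ⊗ G) Y)`. -/
def contractRight (G : Matrix κ κ ℂ) (Y : Matrix (ι × κ) (ι × κ) ℂ) : Matrix ι ι ℂ :=
  Matrix.of fun b b' => ∑ c, ∑ c', G c c' * Y (b, c') (b', c)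

theorem trace_kronecker_mul (R : Matrix ι ι ℂ) (G : Matrix κ κ ℂ)
    (Y : Matrix (ι × κ) (ι × κ) ℂ) : ((R ⊗ₖ G) * Y).trace = (R * contractRight G Y).trace := by
  simp only [trace, diag_apply, mul_apply, Fintype.sum_prod_type, kroneckerMap_apply,
    contractRight, of_apply, Finset.mul_sum]
  refine Finset.sum_congr rfl fun b _ => ?_
  rw [Finset.sum_comm]
  refine Finset.sum_congr rfl fun b' _ => Finset.sum_congr rfl fun c _ =>
    Finset.sum_congr rfl fun c' _ => ?_
  ring

theorem ptraceRight_eq_sum_submatrix (Y : Matrix (ι × κ) (ι × κ) ℂ) :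
    ptraceRight Y = ∑ c, Y.submatrix (fun b => (b, c)) fun b => (b, c) := by
  ext b b'
  simp [ptraceRight, Matrix.sum_apply]

theorem ptraceRight_posSemidef {Y : Matrix (ι × κ) (ι × κ) ℂ} (hY : Y.PosSemidef) :
    (ptraceRight Y).PosSemidef := by
  rw [ptraceRight_eq_sum_submatrix]
  exact posSemidef_sum _ fun c _ => hY.submatrix _

theorem trace_ptraceRight (Y : Matrix (ι × κ) (ι × κ) ℂ) : (ptraceRight Y).trace = Y.trace := by
  simp [trace, ptraceRight, Fintype.sum_prod_type]

/-- In an eigenbasis of the contracting operator, the contraction is a weighted sum of diagonal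
blocks; this lets the compression and Hölder inequalities above act on it. -/
theorem contractRight_conj_diagonal (U : Matrix κ κ ℂ) (l : κ → ℂ)
    (Y : Matrix (ι × κ) (ι × κ) ℂ) :
    contractRight (U * diagonal l * Uᴴ) Y =
      ∑ i, l i • ((1 ⊗ₖ Uᴴ) * Y * (1 ⊗ₖ Uᴴ)ᴴ).submatrix (fun b => (b, i)) fun b => (b, i) := by
  ext b b'
  have hG : ∀ c c', (U * diagonal l * Uᴴ) c c' = ∑ i, U c i * l i * star (U c' i) := by
    intro c c'
    simp only [mul_apply (N := Uᴴ), mul_diagonal, conjTranspose_apply]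
  have hY : ∀ i, ((1 ⊗ₖ Uᴴ) * Y * (1 ⊗ₖ Uᴴ)ᴴ : Matrix (ι × κ) (ι × κ) ℂ) (b, i) (b', i) =
      ∑ c, ∑ c', star (U c' i) * Y (b, c') (b', c) * U c i := by
    intro i
    simp only [conjTranspose_kronecker, conjTranspose_conjTranspose, conjTranspose_one, mul_apply,
      Fintype.sum_prod_type, kroneckerMap_apply, conjTranspose_apply, one_apply, ite_mul, one_mul,
      zero_mul, mul_ite, mul_zero, Finset.sum_mul]
    rw [Finset.sum_eq_single b' (fun x _ hx => by simp [hx]) (by simp)]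
    refine Finset.sum_congr rfl fun c _ => ?_
    rw [Finset.sum_eq_single b (fun x _ hx => by simp [Ne.symm hx]) (by simp)]
    simp
  simp only [contractRight, of_apply, hG, Matrix.sum_apply, Matrix.smul_apply, submatrix_apply, hY,
    smul_eq_mul, Finset.sum_mul, Finset.mul_sum]
  conv_rhs => rw [Finset.sum_comm]
  refine Finset.sum_congr rfl fun c _ => ?_
  rw [Finset.sum_comm]
  refine Finset.sum_congr rfl fun i _ => Finset.sum_congr rfl fun c' _ => ?_
  ring

/-- The operator Hölder inequality behind the multiplicativity of `1 → p` norms of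
entanglement-breaking maps. -/
theorem contractRight_matPow_le {p r : ℝ} (hp : 1 < p) (hr : r = (p - 1) / p)
    {G : Matrix κ κ ℂ} (hG : G.PosSemidef) {W : Matrix (ι × κ) (ι × κ) ℂ} (hW : W.PosSemidef) :
    (((trPow p G ^ (1 / p) : ℝ) : ℂ) • matPow (ptraceRight W) r -
      contractRight G (matPow W r)).PosSemidef := by
  have hp0 : 0 < p := by linarith
  have hr' : r ∈ Set.Icc (0 : ℝ) 1 := by
    rw [hr]
    exact ⟨div_nonneg (by linarith) hp0.le, (div_le_one hp0).2 (by linarith)⟩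
  obtain ⟨U, hU, l, hl, rfl⟩ := exists_spectral_nonneg hG
  have hV : (1 : Matrix ι ι ℂ) ⊗ₖ Uᴴ ∈ unitaryGroup (ι × κ) ℂ := by
    rw [mem_unitaryGroup_iff, star_eq_conjTranspose, conjTranspose_kronecker, ← mul_kronecker_mul,
      conjTranspose_conjTranspose, unitary_conjTranspose_mul hU, conjTranspose_one, Matrix.one_mul,
      one_kronecker_one]
  set V := (1 : Matrix ι ι ℂ) ⊗ₖ Uᴴ with hVdef
  have hW' : (V * W * Vᴴ).PosSemidef := hW.mul_mul_conjTranspose_same V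
  have hpt : ptraceRight W = ∑ i, (V * W * Vᴴ).submatrix (fun b => (b, i)) fun b => (b, i) := by
    -- With all weights one the contracting operator is the identity, so the partial trace is the
    -- unweighted sum of the same blocks.
    have h := contractRight_conj_diagonal U (fun _ => 1) W
    rw [diagonal_one, Matrix.mul_one, unitary_mul_conjTranspose hU] at h
    simp only [one_smul] at h
    rw [← h]
    ext b b'
    simp [ptraceRight, contractRight, one_apply]
  rw [trPow_conj_diagonal hU, contractRight_conj_diagonal, ← hVdef, hpt, ← matPow_unitary_conj hV hW]
  -- `h1` is Hölder across the diagonal blocks of the rotated `W`; `h2` is Jensen, replacing the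
  -- r-th power of each block by the block of the r-th power.
  have h1 := sum_smul_matPow_le hp hr (w := fun i =>
    (V * W * Vᴴ).submatrix (fun b => (b, i)) fun b => (b, i)) (fun i => hW'.submatrix _) hl
  have h2 : (∑ i, (l i : ℂ) • (matPow ((V * W * Vᴴ).submatrix (fun b => (b, i)) fun b => (b, i)) r -
      (matPow (V * W * Vᴴ) r).submatrix (fun b => (b, i)) fun b => (b, i))).PosSemidef :=
    posSemidef_sum _ fun i _ => (matPow_submatrix_le hW' hr' (f := fun b => (b, i))
      fun b b' h => (Prod.mk.inj h).1).smul (by simpa using hl i)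
  have h3 := h1.add h2
  simp only [smul_sub, Finset.sum_sub_distrib] at h3
  rwa [sub_add_sub_cancel] at h3

/-- Test X = ∑ R_x ⊗ G_x against X^(p-1) = (X^p)^r. Operator Hölder contracts each G_x at cost
C^(1/p) t_x, leaving ∑ t_x R_x paired with one operator Z independent of x; Young and absorption
finish. -/
theorem trPow_sum_kronecker_le {n : Type*} [Fintype n] {p : ℝ} (hp : 1 < p)
    {R : n → Matrix ι ι ℂ} (hR : ∀ x, (R x).PosSemidef) {G : n → Matrix κ κ ℂ}
    (hG : ∀ x, (G x).PosSemidef) {t : n → ℝ} (ht : ∀ x, 0 ≤ t x) {C : ℝ} (hC : 0 ≤ C)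
    (h : ∀ x, trPow p (G x) ≤ C * t x ^ p) :
    trPow p (∑ x, R x ⊗ₖ G x) ≤ C * trPow p (∑ x, (t x : ℂ) • R x) := by
  have hp0 : 0 < p := by linarith
  have hpq := Real.HolderConjugate.conjExponent hp
  set r := (p - 1) / p with hr
  set X := ∑ x, R x ⊗ₖ G x with hXdef
  have hX : X.PosSemidef := posSemidef_sum _ fun x _ => (hR x).kronecker (hG x)
  set W := matPow X p with hWdef
  have hW : W.PosSemidef := matPow_posSemidef hX p
  have hY : matPow X (p - 1) = matPow W r := by
    rw [hWdef, matPow_matPow hX, hr, mul_div_cancel₀ _ hp0.ne']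
  set Z := matPow (ptraceRight W) r with hZdef
  have hptW := ptraceRight_posSemidef hW
  have hZ : Z.PosSemidef := matPow_posSemidef hptW r
  set S := ∑ x, (t x : ℂ) • R x with hSdef
  have hS : S.PosSemidef :=
    posSemidef_sum _ fun x _ => (hR x).smul (by simpa using ht x)
  have hC' : 0 ≤ C ^ (1 / p) := Real.rpow_nonneg hC _
  -- Z^q is the partial trace of X^p, so Tr Z^q = Tr X^p, which is the term to be absorbed.
  have hqr : trPow (Real.conjExponent p) Z = trPow p X := by
    have : r * Real.conjExponent p = 1 := by
      rw [hr, Real.conjExponent]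
      field_simp [(by linarith : p - 1 ≠ 0)]
    rw [trPow, hZdef, matPow_matPow hptW, this, matPow_one hptW, trace_ptraceRight, trPow]
  have hbound : ∀ x, ((R x ⊗ₖ G x) * matPow X (p - 1)).trace.re ≤
      C ^ (1 / p) * t x * (R x * Z).trace.re := by
    intro x
    rw [trace_kronecker_mul, hY, trace_mul_comm]
    refine (trace_mul_mono (contractRight_matPow_le hp hr (hG x) hW) (hR x)).trans ?_
    rw [Matrix.smul_mul, trace_smul, smul_eq_mul, Complex.re_ofReal_mul, trace_mul_comm]
    refine mul_le_mul_of_nonneg_right ?_ (Complex.nonneg_iff.1 (trace_mul_nonneg (hR x) hZ)).1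
    calc trPow p (G x) ^ (1 / p) ≤ (C * t x ^ p) ^ (1 / p) :=
          Real.rpow_le_rpow (trPow_nonneg (hG x) p) (h x) (by positivity)
      _ = C ^ (1 / p) * t x := by
          rw [Real.mul_rpow hC (Real.rpow_nonneg (ht x) p), ← Real.rpow_mul (ht x),
            mul_one_div_cancel hp0.ne', Real.rpow_one]
  refine trPow_le_of_trace_mul_le hp hX ?_
  have hCS : (((C ^ (1 / p) : ℝ) : ℂ) • S).PosSemidef := hS.smul (by simpa using hC')
  calc (X * matPow X (p - 1)).trace.re
      = ∑ x, ((R x ⊗ₖ G x) * matPow X (p - 1)).trace.re := by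
        conv_lhs => enter [1, 1, 1]; rw [hXdef]
        rw [Finset.sum_mul, trace_sum, Complex.re_sum]
    _ ≤ ∑ x, C ^ (1 / p) * t x * (R x * Z).trace.re := Finset.sum_le_sum fun x _ => hbound x
    _ = ((((C ^ (1 / p) : ℝ) : ℂ) • S) * Z).trace.re := by
        rw [hSdef, Finset.smul_sum, Finset.sum_mul, trace_sum, Complex.re_sum]
        refine Finset.sum_congr rfl fun x _ => ?_
        rw [smul_smul, ← Complex.ofReal_mul, Matrix.smul_mul, trace_smul, smul_eq_mul,
          Complex.re_ofReal_mul]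
    _ ≤ trPow p (((C ^ (1 / p) : ℝ) : ℂ) • S) / p + trPow (Real.conjExponent p) Z /
          Real.conjExponent p := trace_mul_le_young hpq hCS hZ
    _ = _ := by
        rw [trPow_smul hS hC', ← Real.rpow_mul hC, one_div_mul_cancel hp0.ne', Real.rpow_one, hqr]
        congr 1
        rw [Real.conjExponent]
        field_simp

end King

/-! ### Multiplicativity for tensor powers of entanglement-breaking maps -/

section Tensor

variable {A B : Type*} [Fintype A] [DecidableEq A] [Fintype B] [DecidableEq B]

theorem ofReal_re_trace_mul {M X : Matrix A A ℂ} (hM : M.PosSemidef) (hX : X.PosSemidef) :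
    (((M * X).trace.re : ℝ) : ℂ) = (M * X).trace :=
  (Complex.eq_re_of_ofReal_le (r := 0) (by simpa using trace_mul_nonneg hM hX)).symm

theorem IsEntanglementBreaking.posSemidef {N : Matrix A A ℂ →ₗ[ℂ] Matrix B B ℂ}
    (hN : IsEntanglementBreaking N) {X : Matrix A A ℂ} (hX : X.PosSemidef) : (N X).PosSemidef := by
  obtain ⟨k, R, M, hR, hM, h⟩ := hN
  rw [h]
  exact posSemidef_sum _ fun x _ => (hR x).smul (trace_mul_nonneg (hM x) hX)

theorem contractRight_posSemidef {ι κ : Type*} [Fintype ι] [DecidableEq ι] [Fintype κ]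
    [DecidableEq κ] {G : Matrix κ κ ℂ} (hG : G.PosSemidef) {Y : Matrix (ι × κ) (ι × κ) ℂ}
    (hY : Y.PosSemidef) : (contractRight G Y).PosSemidef := by
  obtain ⟨U, hU, l, hl, rfl⟩ := exists_spectral_nonneg hG
  rw [contractRight_conj_diagonal]
  exact posSemidef_sum _ fun i _ => ((hY.mul_mul_conjTranspose_same _).submatrix _).smul
    (by simpa using hl i)

/-- Splitting off the first tensor factor, placed last. -/
def snocEquivHead (A : Type*) (n : ℕ) : (Fin n → A) × A ≃ (Fin (n + 1) → A) :=
  (Equiv.prodComm _ _).trans (Fin.consEquiv fun _ => A)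

theorem sum_comm_five {K F : Type*} [Fintype K] [Fintype F] (f : A → F → A → F → K → ℂ) :
    ∑ a, ∑ b, ∑ c, ∑ d, ∑ x, f a b c d x = ∑ x, ∑ b, ∑ d, ∑ c, ∑ a, f a b c d x := by
  simp only [← Fintype.sum_prod_type']
  let e : A × F × A × F × K ≃ K × F × F × A × A :=
    { toFun := fun ⟨a, b, c, d, x⟩ => ⟨x, b, d, c, a⟩
      invFun := fun ⟨x, b, d, c, a⟩ => ⟨a, b, c, d, x⟩
      left_inv := fun _ => rfl
      right_inv := fun _ => rfl }
  exact Fintype.sum_equiv e _ _ fun _ => rfl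

/-- Measuring the first site with outcome `x` prepares `R x` there and leaves on the other sites an
unnormalised conditional state, to which the remaining factors apply; no entanglement with the first
site survives. -/
theorem tensorPower_succ {N : Matrix A A ℂ →ₗ[ℂ] Matrix B B ℂ} {k : ℕ} {R : Fin k → Matrix B B ℂ}
    {M : Fin k → Matrix A A ℂ} (h : ∀ X, N X = ∑ x, (M x * X).trace • R x) (n : ℕ)
    (ρ : Matrix (Fin (n + 1) → A) (Fin (n + 1) → A) ℂ) :
    (tensorPower N (n + 1) ρ).submatrix (Fin.consEquiv fun _ => B) (Fin.consEquiv fun _ => B) =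
      ∑ x, R x ⊗ₖ tensorPower N n
        (contractRight (M x) (ρ.submatrix (snocEquivHead A n) (snocEquivHead A n))) := by
  have hs : ∀ a a' b b', N (single a a' 1) b b' = ∑ x, M x a' a * R x b b' := by
    intro a a' b b'
    rw [h, Matrix.sum_apply]
    refine Finset.sum_congr rfl fun x _ => ?_
    rw [Matrix.smul_apply, smul_eq_mul, trace_mul_single]
    simp
  ext ⟨b, β⟩ ⟨b', β'⟩
  simp only [submatrix_apply, tensorPower, LinearMap.coe_mk, AddHom.coe_mk, of_apply,
    Matrix.sum_apply, kroneckerMap_apply, contractRight, Fin.prod_univ_succ]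
  simp only [← (Fin.consEquiv fun _ => A).sum_comp, Fintype.sum_prod_type]
  simp only [snocEquivHead, Fin.consEquiv_apply, Fin.cons_zero, Fin.cons_succ, hs, Equiv.trans_apply,
    Equiv.prodComm_apply, Prod.swap_prod_mk, Finset.sum_mul, Finset.mul_sum]
  rw [sum_comm_five]
  refine Finset.sum_congr rfl fun x _ => Finset.sum_congr rfl fun _ _ =>
    Finset.sum_congr rfl fun _ _ => Finset.sum_congr rfl fun _ _ =>
    Finset.sum_congr rfl fun _ _ => ?_
  ring

/-- The one-dimensional operator is put in spectral form so that the lemmas on conjugated diagonal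
matrices apply to it. -/
theorem tensorPower_zero (N : Matrix A A ℂ →ₗ[ℂ] Matrix B B ℂ)
    {ρ : Matrix (Fin 0 → A) (Fin 0 → A) ℂ} (hρ : ρ.PosSemidef) :
    tensorPower N 0 ρ = (1 : Matrix (Fin 0 → B) (Fin 0 → B) ℂ) *
      diagonal (fun _ => ((ρ.trace.re : ℝ) : ℂ)) * 1ᴴ := by
  have h : ((ρ.trace.re : ℝ) : ℂ) = ρ.trace :=
    (Complex.eq_re_of_ofReal_le (r := 0) (by simpa using hρ.trace_nonneg)).symm
  rw [h]
  ext b b'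
  simp [tensorPower, trace, Subsingleton.elim b b']

theorem IsEntanglementBreaking.tensorPower_posSemidef {N : Matrix A A ℂ →ₗ[ℂ] Matrix B B ℂ}
    (hN : IsEntanglementBreaking N) (n : ℕ) {ρ : Matrix (Fin n → A) (Fin n → A) ℂ}
    (hρ : ρ.PosSemidef) : (tensorPower N n ρ).PosSemidef := by
  obtain ⟨k, R, M, hR, hM, h⟩ := hN
  induction n with
  | zero =>
    rw [tensorPower_zero N hρ]
    exact posSemidef_conj_diagonal _ fun _ => (Complex.nonneg_iff.1 hρ.trace_nonneg).1
  | succ n ih =>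
    rw [← posSemidef_submatrix_equiv (Fin.consEquiv fun _ => B), tensorPower_succ h]
    exact posSemidef_sum _ fun x _ =>
      (hR x).kronecker (ih (contractRight_posSemidef (hM x) (hρ.submatrix _)))

/-- The bound is homogeneous in the trace because the induction feeds it unnormalised conditional
states. -/
theorem trPow_tensorPower_le {N : Matrix A A ℂ →ₗ[ℂ] Matrix B B ℂ} (hN : IsEntanglementBreaking N)
    {α : ℝ} (hα : 1 < α) {V : ℝ} (hV : 0 ≤ V)
    (hNV : ∀ ρ : Matrix A A ℂ, ρ.PosSemidef → trPow α (N ρ) ≤ V * ρ.trace.re ^ α) (n : ℕ) :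
    ∀ ρ : Matrix (Fin n → A) (Fin n → A) ℂ, ρ.PosSemidef →
      trPow α (tensorPower N n ρ) ≤ V ^ n * ρ.trace.re ^ α := by
  obtain ⟨k, R, M, hR, hM, h⟩ := id hN
  induction n with
  | zero =>
    intro ρ hρ
    rw [tensorPower_zero N hρ, trPow_conj_diagonal (one_mem _)]
    simp
  | succ n ih =>
    intro ρ hρ
    set Y := ρ.submatrix (snocEquivHead A n) (snocEquivHead A n) with hYdef
    have hY : Y.PosSemidef := hρ.submatrix _
    set G := fun x => tensorPower N n (contractRight (M x) Y) with hGdef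
    have hC := fun x => contractRight_posSemidef (hM x) hY
    have hG : ∀ x, (G x).PosSemidef := fun x => hN.tensorPower_posSemidef n (hC x)
    have hsucc := tensorPower_succ h n ρ
    set T := tensorPower N (n + 1) ρ with hTdef
    have hT : T = (∑ x, R x ⊗ₖ G x).submatrix (Fin.consEquiv fun _ => B).symm
        (Fin.consEquiv fun _ => B).symm := by
      rw [← hsucc]
      simp
    have hsum : (∑ x, R x ⊗ₖ G x).PosSemidef :=
      posSemidef_sum _ fun x _ => (hR x).kronecker (hG x)
    -- The reduced state of the first site: Tr(M_x ρA) is the trace of the x-th conditional state,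
    -- so ∑ t_x R_x = N(ρA), to which the one-copy bound applies.
    set ρA : Matrix A A ℂ := ∑ a, Y.submatrix (fun c => (a, c)) fun c => (a, c) with hρA
    have hρA' : ρA.PosSemidef := posSemidef_sum _ fun a _ => hY.submatrix _
    have htr : ∀ x, (contractRight (M x) Y).trace = (M x * ρA).trace := by
      intro x
      simp only [trace, diag_apply, contractRight, of_apply, mul_apply, hρA, Matrix.sum_apply,
        submatrix_apply, Finset.mul_sum]
      rw [Finset.sum_comm]
    have htrρ : ρA.trace = ρ.trace := by
      rw [hρA, trace_sum]
      have : ρ.trace = Y.trace := (Equiv.sum_comp (snocEquivHead A n) fun i => ρ i i).symm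
      rw [this]
      simp only [trace, diag_apply, submatrix_apply, Fintype.sum_prod_type]
    rw [hT, trPow_submatrix_equiv hsum]
    have hk := trPow_sum_kronecker_le hα hR hG
      (t := fun x => (contractRight (M x) Y).trace.re) (C := V ^ n)
      (fun x => (Complex.nonneg_iff.1 (hC x).trace_nonneg).1) (pow_nonneg hV n)
      fun x => ih _ (hC x)
    refine hk.trans ?_
    have hS : ∑ x, (((contractRight (M x) Y).trace.re : ℝ) : ℂ) • R x = N ρA := by
      rw [h]
      refine Finset.sum_congr rfl fun x _ => ?_
      rw [htr, ofReal_re_trace_mul (hM x) hρA']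
    rw [hS, pow_succ, mul_assoc, ← htrρ]
    exact mul_le_mul_of_nonneg_left (hNV ρA hρA') (pow_nonneg hV n)

end Tensor

/-! ### The sandwiched trace function: convexity, continuity, regularisation -/

section Sandwich

open scoped MatrixOrder Matrix.Norms.L2Operator

variable {ι κ : Type*} [Fintype ι] [DecidableEq ι] [Fintype κ] [DecidableEq κ]

theorem ofReal_smul_matrix (c : ℝ) (A : Matrix ι ι ℂ) : (c : ℂ) • A = c • A := by
  ext i j
  simp

/-- σ^(-s) is the inverse of σ^s: the inner power is operator concave, and inversion is operator
antitone and convex on positive definite matrices. -/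
theorem matPow_neg_convex {s : ℝ} (hs : s ∈ Set.Icc (0 : ℝ) 1) {σ₁ σ₂ : Matrix ι ι ℂ}
    (h₁ : σ₁.PosDef) (h₂ : σ₂.PosDef) {a b : ℝ} (ha : 0 ≤ a) (hb : 0 ≤ b) (hab : a + b = 1) :
    ((a : ℂ) • matPow σ₁ (-s) + (b : ℂ) • matPow σ₂ (-s) -
      matPow ((a : ℂ) • σ₁ + (b : ℂ) • σ₂) (-s)).PosSemidef := by
  have hc : ∀ {σ : Matrix ι ι ℂ}, σ.PosSemidef → matPow σ (-s) = matPow (matPow σ s) (-1) := by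
    intro σ hσ
    rw [matPow_matPow hσ, mul_neg_one]
  have hpd : ∀ {σ : Matrix ι ι ℂ}, σ.PosDef → IsStrictlyPositive (matPow σ s) := by
    intro σ hσ
    rw [matPow_eq_rpow hσ.posSemidef]
    exact IsStrictlyPositive.rpow σ s (isStrictlyPositive_iff_posDef.2 hσ)
  have hσ : ((a : ℂ) • σ₁ + (b : ℂ) • σ₂).PosSemidef :=
    (h₁.posSemidef.smul (by simpa using ha)).add (h₂.posSemidef.smul (by simpa using hb))
  rw [hc h₁.posSemidef, hc h₂.posSemidef, hc hσ, ← Matrix.le_iff]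
  have hp₁ := hpd h₁
  have hp₂ := hpd h₂
  have hconc := (CFC.concaveOn_rpow (A := Matrix ι ι ℂ) hs).2
    (Set.mem_Ici.2 h₁.posSemidef.nonneg) (Set.mem_Ici.2 h₂.posSemidef.nonneg) ha hb hab
  simp only [] at hconc
  rw [← ofReal_smul_matrix a, ← ofReal_smul_matrix b, ← ofReal_smul_matrix a,
    ← ofReal_smul_matrix b, ← matPow_eq_rpow hσ,
    ← matPow_eq_rpow h₁.posSemidef, ← matPow_eq_rpow h₂.posSemidef] at hconc
  have hconv := CStarAlgebra.convexOn_ringInverse (A := Matrix ι ι ℂ)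
  have hmem := hconv.1 hp₁ hp₂ ha hb hab
  have h := hconv.2 hp₁ hp₂ ha hb hab
  rw [← ofReal_smul_matrix a, ← ofReal_smul_matrix b] at hmem
  have hmem' : IsStrictlyPositive ((a : ℂ) • matPow σ₁ s + (b : ℂ) • matPow σ₂ s) := hmem
  rw [← ofReal_smul_matrix a, ← ofReal_smul_matrix b, ← ofReal_smul_matrix a,
    ← ofReal_smul_matrix b, CFC.inverse_eq_rpow_neg_one hp₁, CFC.inverse_eq_rpow_neg_one hp₂,
    CFC.inverse_eq_rpow_neg_one hmem'] at h
  have h' := CStarAlgebra.rpow_neg_one_le_rpow_neg_one hconc hmem'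
  rw [matPow_eq_rpow (matPow_posSemidef hσ s), matPow_eq_rpow (matPow_posSemidef h₁.posSemidef s),
    matPow_eq_rpow (matPow_posSemidef h₂.posSemidef s)]
  exact h'.trans h

/-- The trace function `Tr (σ ^ ((1 - α) / 2α) ω σ ^ ((1 - α) / 2α)) ^ α`. -/
noncomputable def sandwichTr (α : ℝ) (ω σ : Matrix ι ι ℂ) : ℝ :=
  trPow α (matPow σ ((1 - α) / (2 * α)) * ω * matPow σ ((1 - α) / (2 * α)))

theorem sandwich_posSemidef {ω σ : Matrix ι ι ℂ} (hω : ω.PosSemidef) (hσ : σ.PosSemidef) (s : ℝ) :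
    (matPow σ s * ω * matPow σ s).PosSemidef := by
  have h := hω.mul_mul_conjTranspose_same (matPow σ s)
  rwa [(matPow_posSemidef hσ s).1] at h

/-- Exchanging XᴴX and XXᴴ for X = ω^(1/2) σ^((1-α)/2α) gathers σ into a single power, in which the
operator inside the trace is linear. -/
theorem sandwichTr_eq {α : ℝ} (hα : 1 < α) {ω σ : Matrix ι ι ℂ} (hω : ω.PosSemidef)
    (hσ : σ.PosSemidef) : sandwichTr α ω σ =
      trPow α (matPow ω (1 / 2) * matPow σ (-((α - 1) / α)) * matPow ω (1 / 2)) := by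
  set τ := matPow σ ((1 - α) / (2 * α)) with hτ
  set h := matPow ω (1 / 2) with hh
  have hτH : τᴴ = τ := (matPow_posSemidef hσ _).1
  have hhH : hᴴ = h := (matPow_posSemidef hω _).1
  have hhh : h * h = ω := by
    rw [hh, matPow_mul_matPow hω (by norm_num)]
    norm_num [matPow_one hω]
  have hττ : τ * τ = matPow σ (-((α - 1) / α)) := by
    have : (1 - α) / (2 * α) + (1 - α) / (2 * α) = -((α - 1) / α) := by
      field_simp
      ring
    rw [hτ, matPow_mul_matPow hσ, this]
    rw [this]
    exact neg_ne_zero.2 (div_pos (by linarith) (by linarith)).ne'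
  have := trPow_conjTranspose_mul_self (h * τ) α
  rw [conjTranspose_mul, hτH, hhH] at this
  rw [sandwichTr, ← hhh, ← hττ]
  simp only [Matrix.mul_assoc] at this ⊢
  exact this

theorem sandwichTr_convex {α : ℝ} (hα : 1 < α) {ω σ₁ σ₂ : Matrix ι ι ℂ} (hω : ω.PosSemidef)
    (h₁ : σ₁.PosDef) (h₂ : σ₂.PosDef) {a b : ℝ} (ha : 0 ≤ a) (hb : 0 ≤ b) (hab : a + b = 1) :
    sandwichTr α ω ((a : ℂ) • σ₁ + (b : ℂ) • σ₂) ≤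
      a * sandwichTr α ω σ₁ + b * sandwichTr α ω σ₂ := by
  have hσ : ((a : ℂ) • σ₁ + (b : ℂ) • σ₂).PosSemidef :=
    (h₁.posSemidef.smul (by simpa using ha)).add (h₂.posSemidef.smul (by simpa using hb))
  rw [sandwichTr_eq hα hω hσ, sandwichTr_eq hα hω h₁.posSemidef, sandwichTr_eq hα hω h₂.posSemidef]
  have hs : (α - 1) / α ∈ Set.Icc (0 : ℝ) 1 :=
    ⟨div_nonneg (by linarith) (by linarith), (div_le_one (by linarith)).2 (by linarith)⟩
  refine trPow_convex_mono hα (sandwich_posSemidef (matPow_posSemidef hσ _) hω _)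
    (sandwich_posSemidef (matPow_posSemidef h₁.posSemidef _) hω _)
    (sandwich_posSemidef (matPow_posSemidef h₂.posSemidef _) hω _) ha hb hab ?_
  have h := sandwich_posSemidef (matPow_neg_convex hs h₁ h₂ ha hb hab) hω (1 / 2)
  simpa only [Matrix.mul_sub, Matrix.mul_add, Matrix.sub_mul, Matrix.add_mul, Matrix.mul_smul,
    Matrix.smul_mul] using h

theorem continuousOn_sandwichTr {α : ℝ} (hα : 1 < α) {ω : Matrix ι ι ℂ} (hω : ω.PosSemidef) :
    ContinuousOn (fun σ => sandwichTr α ω σ) {σ : Matrix ι ι ℂ | σ.PosDef} := by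
  have h1 : ContinuousOn (fun σ : Matrix ι ι ℂ => matPow σ ((1 - α) / (2 * α)))
      {σ : Matrix ι ι ℂ | σ.PosDef} := by
    refine ((CFC.continuousOn_rpow (A := Matrix ι ι ℂ) ((1 - α) / (2 * α))).mono
      fun σ hσ => isStrictlyPositive_iff_posDef.2 hσ).congr fun σ hσ => ?_
    exact matPow_eq_rpow (PosDef.posSemidef hσ) _
  have h2 : ContinuousOn (fun X : Matrix ι ι ℂ => matPow X α) {X : Matrix ι ι ℂ | 0 ≤ X} := by
    have hα0 : 0 < α := by linarith
    refine (CFC.continuousOn_nnrpow (A := Matrix ι ι ℂ) (⟨α, hα0.le⟩ : NNReal)).congr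
      fun X hX => ?_
    rw [matPow_eq_rpow (nonneg_iff_posSemidef.1 hX)]
    exact (CFC.nnrpow_eq_rpow (x := (⟨α, hα0.le⟩ : NNReal)) hα0).symm
  have h3 : ContinuousOn (fun σ : Matrix ι ι ℂ =>
      matPow σ ((1 - α) / (2 * α)) * ω * matPow σ ((1 - α) / (2 * α)))
      {σ : Matrix ι ι ℂ | σ.PosDef} := (h1.mul continuousOn_const).mul h1
  have h4 := h2.comp h3 fun σ hσ =>
    (sandwich_posSemidef hω (PosDef.posSemidef hσ) _).nonneg
  have h5 : Continuous fun X : Matrix ι ι ℂ => X.trace.re :=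
    Complex.continuous_re.comp (continuous_id.matrix_trace)
  exact h5.comp_continuousOn h4

/-- On the support of σ, ((1-ε)σ + δ)^(-s) ≤ (1-ε)^(-s) σ^(-s) since t^(-s) is decreasing. On the
kernel this fails, because σ^(-s) is zero there by convention, but `hker` makes ω^(1/2) vanish on
it. -/
theorem sandwichTr_mix_le {α : ℝ} (hα : 1 < α) {ω σ : Matrix ι ι ℂ} (hω : ω.PosSemidef)
    (hσ : σ.PosSemidef) (hker : ∀ v, σ *ᵥ v = 0 → ω *ᵥ v = 0) {ε δ : ℝ} (hε : ε < 1)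
    (hδ : 0 ≤ δ) :
    sandwichTr α ω (((1 - ε : ℝ) : ℂ) • σ + (δ : ℂ) • (1 : Matrix ι ι ℂ)) ≤
      (1 - ε) ^ (1 - α) * sandwichTr α ω σ := by
  have hε' : 0 < 1 - ε := by linarith
  have hα0 : 0 < α := by linarith
  set s := (α - 1) / α with hs
  have hs0 : 0 < s := div_pos (by linarith) hα0
  have hσ' : (((1 - ε : ℝ) : ℂ) • σ + (δ : ℂ) • (1 : Matrix ι ι ℂ)).PosSemidef :=
    (hσ.smul (by exact_mod_cast hε'.le)).add (PosSemidef.one.smul (by simpa using hδ))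
  have hX := sandwich_posSemidef (matPow_posSemidef hσ (-s)) hω (1 / 2)
  have hX' := sandwich_posSemidef (matPow_posSemidef hσ' (-s)) hω (1 / 2)
  have hc : 0 ≤ (1 - ε) ^ (-s) := Real.rpow_nonneg hε'.le _
  have hcα : (1 - ε) ^ (1 - α) = ((1 - ε) ^ (-s)) ^ α := by
    rw [← Real.rpow_mul hε'.le, hs]
    congr 1
    field_simp
    ring
  rw [sandwichTr_eq hα hω hσ, sandwichTr_eq hα hω hσ', hcα, ← trPow_smul hX hc]
  refine trPow_mono hα hX' (hX.smul (by simpa using hc)) ?_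
  set h := matPow ω (1 / 2) with hh
  have hhH : hᴴ = h := (matPow_posSemidef hω _).1
  have hhh : h * h = ω := by
    rw [hh, matPow_mul_matPow hω (by norm_num)]
    norm_num [matPow_one hω]
  have hker' : ∀ v, σ *ᵥ v = 0 → h *ᵥ v = 0 := by
    intro v hv
    have h1 := hker v hv
    rw [← hhh] at h1
    have h2 : star (h *ᵥ v) ⬝ᵥ (h *ᵥ v) = 0 := by
      rw [star_mulVec, hhH, ← dotProduct_mulVec, mulVec_mulVec, h1, dotProduct_zero]
    exact dotProduct_star_self_eq_zero.1 h2
  obtain ⟨U, hU, d, hd, rfl⟩ := exists_spectral_nonneg hσ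
  have hmix : ((1 - ε : ℝ) : ℂ) • (U * diagonal (fun i => (d i : ℂ)) * Uᴴ) +
      (δ : ℂ) • (1 : Matrix ι ι ℂ) =
      U * diagonal (fun i => (((1 - ε) * d i + δ : ℝ) : ℂ)) * Uᴴ := by
    have : (diagonal fun i => (((1 - ε) * d i + δ : ℝ) : ℂ)) =
        ((1 - ε : ℝ) : ℂ) • diagonal (fun i => (d i : ℂ)) + (δ : ℂ) • (1 : Matrix ι ι ℂ) := by
      ext i j
      by_cases hij : i = j
      · subst hij; simp
      · simp [hij]
    rw [this, Matrix.mul_add, Matrix.add_mul, Matrix.mul_smul, Matrix.smul_mul, Matrix.mul_smul,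
      Matrix.smul_mul, Matrix.mul_one, unitary_mul_conjTranspose hU]
  rw [hmix, matPow_conj_diagonal hU, matPow_conj_diagonal hU]
  have hcol : ∀ i, d i = 0 → ∀ j, (h * U) j i = 0 := by
    intro i hi j
    have h1 : (U * diagonal (fun i => (d i : ℂ)) * Uᴴ) *ᵥ (fun k => U k i) = 0 := by
      have : (U * diagonal (fun i => (d i : ℂ)) * Uᴴ) * U = U * diagonal (fun i => (d i : ℂ)) := by
        rw [Matrix.mul_assoc, unitary_conjTranspose_mul hU, Matrix.mul_one]
      ext k
      have h2 := congrFun (congrFun this k) i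
      rw [mul_diagonal, hi] at h2
      simpa [mulVec, dotProduct, mul_apply] using h2
    exact congrFun (hker' _ h1) j
  -- On kernel directions the true difference is negative when δ > 0; it may be replaced by 0
  -- because the corresponding columns of `h * U` vanish (`hcol`).
  set g : ι → ℝ := fun i => if d i = 0 then 0 else
    (1 - ε) ^ (-s) * d i ^ (-s) - ((1 - ε) * d i + δ) ^ (-s) with hg
  have hg0 : ∀ i, 0 ≤ g i := by
    intro i
    by_cases hi : d i = 0
    · simp [hg, hi]
    · have hdi : 0 < d i := lt_of_le_of_ne (hd i) (Ne.symm hi)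
      simp only [hg, hi, if_false, sub_nonneg]
      rw [← Real.mul_rpow hε'.le (hd i)]
      exact Real.rpow_le_rpow_of_nonpos (by positivity) (by linarith) (by linarith)
  have key : (((1 - ε) ^ (-s) : ℝ) : ℂ) •
        (h * (U * diagonal (fun i => ((d i ^ (-s) : ℝ) : ℂ)) * Uᴴ) * h) -
      h * (U * diagonal (fun i => ((((1 - ε) * d i + δ) ^ (-s) : ℝ) : ℂ)) * Uᴴ) * h =
      (h * U) * diagonal (fun i => (g i : ℂ)) * (h * U)ᴴ := by
    have h1 : ∀ D : Matrix ι ι ℂ, h * (U * D * Uᴴ) * h = (h * U) * D * (h * U)ᴴ := by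
      intro D
      rw [conjTranspose_mul, hhH]
      simp only [Matrix.mul_assoc]
    rw [h1, h1, ← Matrix.smul_mul, ← Matrix.mul_smul, ← Matrix.sub_mul, ← Matrix.mul_sub]
    congr 1
    ext j i
    rw [Matrix.mul_sub, Matrix.sub_apply, Matrix.mul_smul, Matrix.smul_apply, mul_diagonal,
      mul_diagonal, mul_diagonal]
    by_cases hi : d i = 0
    · simp [hcol i hi j]
    · simp only [hg, hi, if_false, smul_eq_mul]
      push_cast
      ring
  rw [key]
  exact posSemidef_conj_diagonal _ hg0

end Sandwich

/-! ### Minimax over states bounded away from singular ones -/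

section Minimax

/-- A minimax theorem: if every finite mixture of the convex functions `f t` takes a value at most
`v` on the compact convex set `K`, then all `f t` are at most `v` at a common point. -/
theorem exists_forall_le_of_mixture {E T : Type*} [TopologicalSpace E] [T2Space E] [AddCommGroup E]
    [Module ℝ E] [IsTopologicalAddGroup E] [ContinuousSMul ℝ E] {K : Set E} (hne : K.Nonempty)
    (hK : IsCompact K) (hconv : Convex ℝ K) {f : T → E → ℝ} (hf : ∀ t, ContinuousOn (f t) K)
    (hf' : ∀ t, ConvexOn ℝ K (f t)) {v : ℝ}
    (h : ∀ (k : ℕ) (p : Fin k → ℝ) (t : Fin k → T), (∀ x, 0 ≤ p x) → ∑ x, p x = 1 →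
      ∃ σ ∈ K, ∑ x, p x * f (t x) σ ≤ v) :
    ∃ σ ∈ K, ∀ t, f t σ ≤ v := by
  -- By compactness of `K` it is enough to treat finite families, for which the mixing weights range
  -- over a simplex and Sion's theorem applies.
  have hfin : ∀ u : Finset T, (K ∩ ⋂ t ∈ u, K ∩ f t ⁻¹' Set.Iic v).Nonempty := by
    intro u
    rcases u.eq_empty_or_nonempty with rfl | hu
    · simpa using hne
    have hu0 : 0 < u.card := hu.card_pos
    let e := u.equivFin
    let t : Fin u.card → T := fun x => (e.symm x).1
    have hY : (stdSimplex ℝ (Fin u.card)).Nonempty := ⟨_, single_mem_stdSimplex ℝ ⟨0, hu0⟩⟩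
    obtain ⟨a, ha, b, hb, hab⟩ := Sion.exists_isSaddlePointOn
      (X := K) (Y := stdSimplex ℝ (Fin u.card)) (f := fun σ p => ∑ x, p x * f (t x) σ)
      hne hconv hK
      (fun p _ => (continuousOn_finsetSum _ fun x _ =>
        continuousOn_const.mul (hf (t x))).lowerSemicontinuousOn)
      (fun p hp => by
        refine ConvexOn.quasiconvexOn ⟨hconv, fun x hx y hy c d hc hd hcd => ?_⟩
        simp only [smul_eq_mul, Finset.mul_sum, ← Finset.sum_add_distrib]
        refine Finset.sum_le_sum fun i _ => ?_
        have h1 := mul_le_mul_of_nonneg_left ((hf' (t i)).2 hx hy hc hd hcd) (hp.1 i)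
        refine h1.trans (le_of_eq ?_)
        simp only [smul_eq_mul]
        ring)
      (convex_stdSimplex ℝ _) hY (isCompact_stdSimplex ℝ _)
      (fun σ _ => (Continuous.continuousOn (by fun_prop)).upperSemicontinuousOn)
      (fun σ _ => by
        refine ConcaveOn.quasiconcaveOn ⟨convex_stdSimplex ℝ _, fun x _ y _ c d _ _ _ => ?_⟩
        refine le_of_eq ?_
        simp only [smul_eq_mul, Finset.mul_sum, ← Finset.sum_add_distrib, Pi.add_apply,
          Pi.smul_apply]
        refine Finset.sum_congr rfl fun i _ => ?_
        ring)
    -- The hypothesis is used at the saddle weights `b`; then each vertex value at `a` is at most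
    -- the value at (σ, b), hence at most `v`.
    obtain ⟨σ, hσ, hσv⟩ := h u.card b t hb.1 hb.2
    refine ⟨a, ha, Set.mem_iInter₂.2 fun s hs => ⟨ha, ?_⟩⟩
    have h1 := hab σ hσ _ (single_mem_stdSimplex ℝ (e ⟨s, hs⟩))
    have h2 : ∑ x, (Pi.single (e ⟨s, hs⟩) 1 : Fin u.card → ℝ) x * f (t x) a = f s a := by
      rw [Finset.sum_eq_single (e ⟨s, hs⟩) (fun x _ hx => by simp [hx]) (by simp)]
      simp [t]
    simp only [] at h1
    rw [h2] at h1
    exact h1.trans hσv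
  obtain ⟨σ, hσ, hσ'⟩ := hK.inter_iInter_nonempty _
    (fun t => (hf t).preimage_isClosed_of_isClosed hK.isClosed isClosed_Iic) hfin
  exact ⟨σ, hσ, fun t => (Set.mem_iInter.1 hσ' t).2⟩

open scoped MatrixOrder Matrix.Norms.L2Operator

variable {ι : Type*} [Fintype ι] [DecidableEq ι]

/-- The density matrices bounded below by a multiple of the identity. -/
def boundedBelowStates (ι : Type*) [Fintype ι] [DecidableEq ι] (δ : ℝ) : Set (Matrix ι ι ℂ) :=
  {σ | (σ - (δ : ℂ) • (1 : Matrix ι ι ℂ)).PosSemidef ∧ σ.trace = 1}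

theorem boundedBelowStates_posDef {δ : ℝ} (hδ : 0 < δ) {σ : Matrix ι ι ℂ}
    (hσ : σ ∈ boundedBelowStates ι δ) : σ.PosDef := by
  have h : σ = (δ : ℂ) • (1 : Matrix ι ι ℂ) + (σ - (δ : ℂ) • (1 : Matrix ι ι ℂ)) := by abel
  rw [h]
  exact (PosDef.one.smul (by simpa using hδ)).add_posSemidef hσ.1

theorem le_one_of_trace_eq_one {σ : Matrix ι ι ℂ} (hσ : σ.PosSemidef) (htr : σ.trace = 1) :
    σ ≤ 1 := by
  obtain ⟨U, hU, d, hd, rfl⟩ := exists_spectral_nonneg hσ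
  rw [trace_conj_diagonal hU] at htr
  have hsum : ∑ i, d i = 1 := by exact_mod_cast htr
  rw [Matrix.le_iff]
  have h : 1 - U * diagonal (fun i => (d i : ℂ)) * Uᴴ =
      U * diagonal (fun i => ((1 - d i : ℝ) : ℂ)) * Uᴴ := by
    have : (diagonal fun i => ((1 - d i : ℝ) : ℂ)) = 1 - diagonal (fun i => (d i : ℂ)) := by
      ext i j
      by_cases hij : i = j
      · subst hij; simp
      · simp [hij]
    rw [this, Matrix.mul_sub, Matrix.sub_mul, Matrix.mul_one, unitary_mul_conjTranspose hU]
  rw [h]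
  refine posSemidef_conj_diagonal U fun i => ?_
  have := Finset.single_le_sum (fun i _ => hd i) (Finset.mem_univ i)
  linarith

theorem isCompact_boundedBelowStates {δ : ℝ} (hδ : 0 < δ) :
    IsCompact (boundedBelowStates ι δ) := by
  have : ProperSpace (Matrix ι ι ℂ) := FiniteDimensional.proper ℂ _
  refine Metric.isCompact_of_isClosed_isBounded ?_ ?_
  · refine IsClosed.inter (s₁ := {σ | (σ - (δ : ℂ) • (1 : Matrix ι ι ℂ)).PosSemidef})
      (s₂ := {σ | σ.trace = 1}) ?_ ?_
    · have h : {σ : Matrix ι ι ℂ | (σ - (δ : ℂ) • (1 : Matrix ι ι ℂ)).PosSemidef} =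
          (fun σ : Matrix ι ι ℂ => σ - (δ : ℂ) • (1 : Matrix ι ι ℂ)) ⁻¹' {X | 0 ≤ X} := by
        ext σ
        exact nonneg_iff_posSemidef.symm
      rw [h]
      exact (CStarAlgebra.isClosed_nonneg (A := Matrix ι ι ℂ)).preimage
        (continuous_id.sub continuous_const)
    · exact isClosed_eq continuous_id.matrix_trace continuous_const
  · refine (Metric.isBounded_iff_subset_closedBall 0).2 ⟨1, fun σ hσ => ?_⟩
    have hpsd := (boundedBelowStates_posDef hδ hσ).posSemidef
    rw [mem_closedBall_zero_iff]
    exact (CStarAlgebra.norm_le_one_iff_of_nonneg σ hpsd.nonneg).2 (le_one_of_trace_eq_one hpsd hσ.2)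

theorem convex_boundedBelowStates (δ : ℝ) : Convex ℝ (boundedBelowStates ι δ) := by
  intro x hx y hy a b ha hb hab
  rw [← ofReal_smul_matrix, ← ofReal_smul_matrix]
  have hab' : (a : ℂ) + b = 1 := by exact_mod_cast hab
  refine ⟨?_, ?_⟩
  · have h : (a : ℂ) • x + (b : ℂ) • y - (δ : ℂ) • (1 : Matrix ι ι ℂ) =
        (a : ℂ) • (x - (δ : ℂ) • (1 : Matrix ι ι ℂ)) +
          (b : ℂ) • (y - (δ : ℂ) • (1 : Matrix ι ι ℂ)) := by
      have h1 : (δ : ℂ) • (1 : Matrix ι ι ℂ) = ((a : ℂ) + b) • (δ : ℂ) • (1 : Matrix ι ι ℂ) := by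
        rw [hab', one_smul]
      conv_lhs => rw [h1]
      rw [smul_sub, smul_sub, add_smul]
      abel
    rw [h]
    exact (hx.1.smul (by simpa using ha)).add (hy.1.smul (by simpa using hb))
  · rw [trace_add, trace_smul, trace_smul, hx.2, hy.2]
    simpa using hab'

theorem exists_state_forall_sandwichTr_le {T : Type*} [Nonempty T] {α : ℝ} (hα : 1 < α) {δ : ℝ} (hδ : 0 < δ)
    {ω : T → Matrix ι ι ℂ}
    (hω : ∀ t, (ω t).PosSemidef) {v : ℝ}
    (h : ∀ (k : ℕ) (p : Fin k → ℝ) (t : Fin k → T), (∀ x, 0 ≤ p x) → ∑ x, p x = 1 →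
      ∃ σ ∈ boundedBelowStates ι δ, ∑ x, p x * sandwichTr α (ω (t x)) σ ≤ v) :
    ∃ σ ∈ boundedBelowStates ι δ, ∀ t, sandwichTr α (ω t) σ ≤ v := by
  obtain ⟨t₀⟩ := ‹Nonempty T›
  have hne : (boundedBelowStates ι δ).Nonempty := by
    obtain ⟨σ, hσ, -⟩ := h 1 (fun _ => 1) (fun _ => t₀) (fun _ => zero_le_one) (by simp)
    exact ⟨σ, hσ⟩
  refine exists_forall_le_of_mixture hne (isCompact_boundedBelowStates hδ)
    (convex_boundedBelowStates δ) (f := fun t σ => sandwichTr α (ω t) σ)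
    (fun t => (continuousOn_sandwichTr hα (hω t)).mono fun σ hσ => boundedBelowStates_posDef hδ hσ)
    (fun t => ⟨convex_boundedBelowStates δ, fun x hx y hy a b ha hb hab => ?_⟩) h
  rw [← ofReal_smul_matrix, ← ofReal_smul_matrix]
  exact sandwichTr_convex hα (hω t) (boundedBelowStates_posDef hδ hx)
    (boundedBelowStates_posDef hδ hy) ha hb hab

end Minimax

/-! ### Quasi-entropy of classical-quantum states -/

section ClassicalQuantum

variable {ι κ : Type*} [Fintype ι] [DecidableEq ι] [Fintype κ] [DecidableEq κ]

theorem supp_le_supp_iff {A B : Matrix ι ι ℂ} :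
    supp A ≤ supp B ↔ ∀ v, B *ᵥ v = 0 → A *ᵥ v = 0 := by
  have h1 : supp A ≤ supp B ↔
      LinearMap.ker (toEuclideanLin B) ≤ LinearMap.ker (toEuclideanLin A) := by
    refine ⟨fun h => ?_, Submodule.orthogonal_le⟩
    have h2 := Submodule.orthogonal_le h
    rwa [supp, supp, Submodule.orthogonal_orthogonal, Submodule.orthogonal_orthogonal] at h2
  rw [h1]
  refine ⟨fun h v hv => ?_, fun h v hv => ?_⟩
  · have h2 : WithLp.toLp 2 v ∈ LinearMap.ker (toEuclideanLin B) := by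
      rw [LinearMap.mem_ker, toLpLin_toLp, toLin'_apply, hv]
      rfl
    have h3 := h h2
    rw [LinearMap.mem_ker, toLpLin_toLp] at h3
    exact congrArg WithLp.ofLp h3
  · rw [LinearMap.mem_ker, toLpLin_apply] at hv ⊢
    rw [h _ (congrArg WithLp.ofLp hv)]
    rfl

theorem ctrlBlock_mulVec (M : κ → Matrix ι ι ℂ) (v : κ × ι → ℂ) (x : κ) (i : ι) :
    (ctrlBlock M *ᵥ v) (x, i) = (M x *ᵥ fun j => v (x, j)) i := by
  simp only [mulVec, dotProduct, ctrlBlock, of_apply, Fintype.sum_prod_type, ite_mul, zero_mul]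
  rw [Finset.sum_eq_single x (fun y _ hy => by simp [Ne.symm hy]) (by simp)]
  simp

theorem cqState_eq_ctrlBlock {k : ℕ} (p : Fin k → ℝ) (ρ : Fin k → Matrix ι ι ℂ) :
    cqState p ρ = ctrlBlock fun x => (p x : ℂ) • ρ x := by
  ext ⟨x, i⟩ ⟨y, j⟩
  simp only [cqState, ctrlBlock, of_apply, Matrix.sum_apply, Matrix.smul_apply, kroneckerMap_apply,
    single_apply, smul_eq_mul]
  by_cases h : x = y
  · subst h
    simp
  · rw [if_neg h]
    refine Finset.sum_eq_zero fun z _ => ?_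
    rw [if_neg (fun hz => h (hz.1.symm.trans hz.2))]
    simp

theorem ptraceRight_cqState_kronecker {k : ℕ} (p : Fin k → ℝ) {ρ : Fin k → Matrix ι ι ℂ}
    (hρ : ∀ x, (ρ x).trace = 1) (σ : Matrix ι ι ℂ) :
    ptraceRight (cqState p ρ) ⊗ₖ σ = ctrlBlock fun x => (p x : ℂ) • σ := by
  ext ⟨x, i⟩ ⟨y, j⟩
  rw [cqState_eq_ctrlBlock]
  simp only [ptraceRight, ctrlBlock, of_apply, Matrix.smul_apply, kroneckerMap_apply, smul_eq_mul]
  by_cases h : x = y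
  · subst h
    have h1 := hρ x
    rw [trace] at h1
    simp only [diag_apply] at h1
    simp [← Finset.mul_sum, h1]
  · simp [h]

theorem supp_cqState_le {k : ℕ} (p : Fin k → ℝ) {ρ : Fin k → Matrix ι ι ℂ}
    (hρ : ∀ x, (ρ x).trace = 1) {σ : Matrix ι ι ℂ} :
    supp (cqState p ρ) ≤ supp (ptraceRight (cqState p ρ) ⊗ₖ σ) ↔
      ∀ x, p x ≠ 0 → ∀ v, σ *ᵥ v = 0 → ρ x *ᵥ v = 0 := by
  rw [ptraceRight_cqState_kronecker p hρ, cqState_eq_ctrlBlock, supp_le_supp_iff]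
  refine ⟨fun h x hx v hv => ?_, fun h v hv => ?_⟩
  · have h1 := h (fun a => if a.1 = x then v a.2 else 0) (by
      ext ⟨y, i⟩
      rw [ctrlBlock_mulVec]
      by_cases hy : y = x
      · simp [hy, smul_mulVec, hv]
      · simp only [hy, if_false]
        exact congrFun (mulVec_zero _) i)
    ext i
    have h2 := congrFun h1 (x, i)
    rw [ctrlBlock_mulVec] at h2
    simpa [smul_mulVec, hx] using h2
  · ext ⟨x, i⟩
    have h1 : ((p x : ℂ) • σ) *ᵥ (fun j => v (x, j)) = 0 := by
      ext j
      rw [← ctrlBlock_mulVec (fun x => (p x : ℂ) • σ), hv]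
      rfl
    rw [ctrlBlock_mulVec]
    by_cases hx : p x = 0
    · simp [hx]
    · rw [smul_mulVec, smul_eq_zero_iff_right (by exact_mod_cast hx)] at h1
      rw [smul_mulVec, h x hx _ h1, smul_zero]
      rfl

/-- Joint degree one: the two outer powers contribute 1 - α and the inner operator α. This is what
makes the quasi-entropy affine in the probabilities. -/
theorem sandwichTr_smul {α : ℝ} (hα : 1 < α) {ω σ : Matrix ι ι ℂ} (hω : ω.PosSemidef)
    (hσ : σ.PosSemidef) {c : ℝ} (hc : 0 ≤ c) :
    sandwichTr α ((c : ℂ) • ω) ((c : ℂ) • σ) = c * sandwichTr α ω σ := by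
  rw [sandwichTr, matPow_smul hσ hc]
  set e := (1 - α) / (2 * α) with he
  have h1 : ((c ^ e : ℝ) : ℂ) • matPow σ e * ((c : ℂ) • ω) * (((c ^ e : ℝ) : ℂ) • matPow σ e) =
      ((c ^ e * c * c ^ e : ℝ) : ℂ) • (matPow σ e * ω * matPow σ e) := by
    simp only [Matrix.smul_mul, Matrix.mul_smul, smul_smul]
    push_cast
    ring_nf
  have hce : 0 ≤ c ^ e := Real.rpow_nonneg hc e
  rw [h1, trPow_smul (sandwich_posSemidef hω hσ e) (by positivity), sandwichTr]
  congr 1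
  have hα0 : 0 < α := by linarith
  rcases hc.eq_or_lt with rfl | hc
  · simp [Real.zero_rpow hα0.ne']
  · rw [show c ^ e * c * c ^ e = c ^ (e + 1 + e) by
      rw [Real.rpow_add hc, Real.rpow_add hc, Real.rpow_one], ← Real.rpow_mul hc.le]
    have : (e + 1 + e) * α = 1 := by
      rw [he]
      field_simp
      ring
    rw [this, Real.rpow_one]

theorem sandwichedQ_cqState {α : ℝ} (hα : 1 < α) {k : ℕ} {p : Fin k → ℝ} (hp : ∀ x, 0 ≤ p x)
    {ρ : Fin k → Matrix ι ι ℂ} (hρ : ∀ x, (ρ x).PosSemidef) (hρ' : ∀ x, (ρ x).trace = 1)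
    {σ : Matrix ι ι ℂ} (hσ : σ.PosSemidef)
    (h : supp (cqState p ρ) ≤ supp (ptraceRight (cqState p ρ) ⊗ₖ σ)) :
    sandwichedQ α (cqState p ρ) (ptraceRight (cqState p ρ) ⊗ₖ σ) =
      ENNReal.ofReal (∑ x, p x * sandwichTr α (ρ x) σ) := by
  rw [sandwichedQ, if_pos h, ptraceRight_cqState_kronecker p hρ', cqState_eq_ctrlBlock]
  have hpσ : ∀ x, ((p x : ℂ) • σ).PosSemidef := fun x => hσ.smul (by simpa using hp x)
  have hpρ : ∀ x, ((p x : ℂ) • ρ x).PosSemidef := fun x => (hρ x).smul (by simpa using hp x)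
  rw [matPow_ctrlBlock hpσ, ctrlBlock_mul, ctrlBlock_mul]
  congr 1
  refine (trPow_ctrlBlock (fun x => sandwich_posSemidef (hpρ x) (hpσ x) _) α).trans ?_
  exact Finset.sum_congr rfl fun x _ => sandwichTr_smul hα (hρ x) hσ (hp x)

end ClassicalQuantum

/-! ### Tensor powers of states and absorption of the sandwich into the map -/

section TensorMatrix

variable {ι : Type*} [Fintype ι] [DecidableEq ι]

/-- The tensor product of a family of matrices. -/
def tensorMat {n : ℕ} (X : Fin n → Matrix ι ι ℂ) : Matrix (Fin n → ι) (Fin n → ι) ℂ :=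
  Matrix.of fun a b => ∏ i, X i (a i) (b i)

theorem tensorMat_mul {n : ℕ} (X Y : Fin n → Matrix ι ι ℂ) :
    tensorMat X * tensorMat Y = tensorMat fun i => X i * Y i := by
  ext a b
  simp only [mul_apply, tensorMat, of_apply, ← Finset.prod_mul_distrib, Finset.prod_univ_sum,
    Fintype.piFinset_univ]

theorem tensorMat_conjTranspose {n : ℕ} (X : Fin n → Matrix ι ι ℂ) :
    (tensorMat X)ᴴ = tensorMat fun i => (X i)ᴴ := by
  ext a b
  simp [tensorMat]

theorem tensorMat_diagonal {n : ℕ} (d : Fin n → ι → ℂ) :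
    tensorMat (fun i => diagonal (d i)) = diagonal fun a => ∏ i, d i (a i) := by
  ext a b
  simp only [tensorMat, of_apply]
  by_cases h : a = b
  · subst h
    simp
  · obtain ⟨i, hi⟩ := Function.ne_iff.1 h
    rw [diagonal_apply_ne _ h]
    exact Finset.prod_eq_zero (Finset.mem_univ i) (diagonal_apply_ne _ hi)

theorem tensorMat_one (n : ℕ) : tensorMat (fun _ : Fin n => (1 : Matrix ι ι ℂ)) = 1 := by
  have h := tensorMat_diagonal fun (_ : Fin n) (_ : ι) => (1 : ℂ)
  simpa using h

theorem trace_tensorMat {n : ℕ} (X : Fin n → Matrix ι ι ℂ) :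
    (tensorMat X).trace = ∏ i, (X i).trace := by
  simp only [trace, diag_apply, tensorMat, of_apply, Finset.prod_univ_sum, Fintype.piFinset_univ]

theorem tensorMat_conj_diagonal (n : ℕ) (U : Matrix ι ι ℂ) (d : ι → ℝ) :
    tensorMat (fun _ : Fin n => U * diagonal (fun i => (d i : ℂ)) * Uᴴ) =
      tensorMat (fun _ : Fin n => U) * diagonal (fun a => ((∏ i, d (a i) : ℝ) : ℂ)) *
        (tensorMat fun _ : Fin n => U)ᴴ := by
  have h : (diagonal fun a : Fin n → ι => ((∏ i, d (a i) : ℝ) : ℂ)) =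
      tensorMat fun _ : Fin n => diagonal fun i => (d i : ℂ) := by
    rw [tensorMat_diagonal]
    simp
  rw [h, tensorMat_conjTranspose, tensorMat_mul, tensorMat_mul]

theorem tensorMat_mem_unitaryGroup (n : ℕ) {U : Matrix ι ι ℂ} (hU : U ∈ unitaryGroup ι ℂ) :
    tensorMat (fun _ : Fin n => U) ∈ unitaryGroup (Fin n → ι) ℂ := by
  rw [mem_unitaryGroup_iff, star_eq_conjTranspose, tensorMat_conjTranspose, tensorMat_mul]
  simp only [unitary_mul_conjTranspose hU, tensorMat_one]

theorem tensorMat_posSemidef (n : ℕ) {σ : Matrix ι ι ℂ} (hσ : σ.PosSemidef) :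
    (tensorMat fun _ : Fin n => σ).PosSemidef := by
  obtain ⟨U, hU, d, hd, rfl⟩ := exists_spectral_nonneg hσ
  rw [tensorMat_conj_diagonal]
  exact posSemidef_conj_diagonal _ fun a => Finset.prod_nonneg fun i _ => hd _

theorem matPow_tensorMat (n : ℕ) {σ : Matrix ι ι ℂ} (hσ : σ.PosSemidef) (s : ℝ) :
    matPow (tensorMat fun _ : Fin n => σ) s = tensorMat fun _ : Fin n => matPow σ s := by
  obtain ⟨U, hU, d, hd, rfl⟩ := exists_spectral_nonneg hσ
  rw [tensorMat_conj_diagonal, matPow_conj_diagonal (tensorMat_mem_unitaryGroup n hU),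
    matPow_conj_diagonal hU, tensorMat_conj_diagonal]
  congr 4
  ext a
  rw [Real.finsetProd_rpow _ _ fun i _ => hd _]

theorem tensorMat_mulVec_eq_zero (n : ℕ) {σ : Matrix ι ι ℂ} (hσ : IsUnit σ) {v : (Fin n → ι) → ℂ}
    (hv : (tensorMat fun _ : Fin n => σ) *ᵥ v = 0) : v = 0 := by
  obtain ⟨τ, hτ⟩ := hσ.exists_left_inv
  have h : (tensorMat fun _ : Fin n => τ) * (tensorMat fun _ : Fin n => σ) = 1 := by
    rw [tensorMat_mul]
    simp only [hτ, tensorMat_one]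
  have h1 := congrArg ((tensorMat fun _ : Fin n => τ) *ᵥ ·) hv
  simpa [mulVec_mulVec, h] using h1

variable {A B : Type*} [Fintype A] [DecidableEq A] [Fintype B] [DecidableEq B]

theorem tensorPower_eq_sum (N : Matrix A A ℂ →ₗ[ℂ] Matrix B B ℂ) (n : ℕ)
    (X : Matrix (Fin n → A) (Fin n → A) ℂ) :
    tensorPower N n X =
      ∑ a, ∑ a', X a a' • tensorMat fun i => N (single (a i) (a' i) 1) := by
  ext b b'
  simp [tensorPower, tensorMat, Matrix.sum_apply]

theorem trace_tensorPower {N : Matrix A A ℂ →ₗ[ℂ] Matrix B B ℂ} (hN : IsTracePreserving N) (n : ℕ)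
    (X : Matrix (Fin n → A) (Fin n → A) ℂ) : (tensorPower N n X).trace = X.trace := by
  simp only [tensorPower_eq_sum, trace_sum, trace_smul, trace_tensorMat, hN _, smul_eq_mul]
  rw [trace]
  refine Finset.sum_congr rfl fun a _ => ?_
  rw [Finset.sum_eq_single a]
  · simp
  · intro a' _ ha
    obtain ⟨i, hi⟩ := Function.ne_iff.1 ha
    rw [Finset.prod_eq_zero (Finset.mem_univ i) (trace_single_eq_of_ne _ _ _ hi.symm), mul_zero]
  · simp

/-- Since powers of σ^{⊗n} factorise, sandwiching the n-copy output amounts to taking the tensor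
power of the sandwiched map. -/
theorem tensorPower_mulLeftRight (N : Matrix A A ℂ →ₗ[ℂ] Matrix B B ℂ) (τ : Matrix B B ℂ) (n : ℕ)
    (X : Matrix (Fin n → A) (Fin n → A) ℂ) :
    tensorPower ((LinearMap.mulLeftRight ℂ (τ, τ)).comp N) n X =
      (tensorMat fun _ => τ) * tensorPower N n X * tensorMat fun _ => τ := by
  simp only [tensorPower_eq_sum, Matrix.mul_sum, Matrix.sum_mul, Matrix.mul_smul, Matrix.smul_mul,
    tensorMat_mul, LinearMap.comp_apply, LinearMap.mulLeftRight_apply]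

theorem isEntanglementBreaking_mulLeftRight {N : Matrix A A ℂ →ₗ[ℂ] Matrix B B ℂ}
    (hN : IsEntanglementBreaking N) {τ : Matrix B B ℂ} (hτ : τ.IsHermitian) :
    IsEntanglementBreaking ((LinearMap.mulLeftRight ℂ (τ, τ)).comp N) := by
  obtain ⟨k, R, M, hR, hM, h⟩ := hN
  refine ⟨k, fun x => τ * R x * τ, M, fun x => ?_, hM, fun X => ?_⟩
  · have h1 := (hR x).mul_mul_conjTranspose_same τ
    rwa [hτ] at h1
  · simp only [LinearMap.comp_apply, LinearMap.mulLeftRight_apply, h, Matrix.mul_sum,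
      Matrix.sum_mul, Matrix.mul_smul, Matrix.smul_mul]

/-- Multiplicativity: a uniform bound on the sandwiched trace function of the outputs of an
entanglement-breaking map is multiplicative under tensor powers. -/
theorem sandwichTr_tensorPower_le {N : Matrix A A ℂ →ₗ[ℂ] Matrix B B ℂ}
    (hN : IsEntanglementBreaking N) {α : ℝ} (hα : 1 < α) {σ : Matrix B B ℂ} (hσ : σ.PosSemidef)
    {V : ℝ} (hV : 0 ≤ V) (h : ∀ ρ : DensityMatrix A, sandwichTr α (N ρ.1) σ ≤ V) (n : ℕ)
    (ρ : DensityMatrix (Fin n → A)) :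
    sandwichTr α (tensorPower N n ρ.1) (tensorMat fun _ => σ) ≤ V ^ n := by
  set τ := matPow σ ((1 - α) / (2 * α)) with hτ
  have hτH : τ.IsHermitian := (matPow_posSemidef hσ _).1
  have hN' := isEntanglementBreaking_mulLeftRight hN hτH
  have h1 := trPow_tensorPower_le hN' hα hV (fun X hX => ?_) n ρ.1 ρ.2.1
  · rw [ρ.2.2, tensorPower_mulLeftRight] at h1
    rw [sandwichTr, matPow_tensorMat n hσ]
    simpa using h1
  · have htr : ((X.trace.re : ℝ) : ℂ) = X.trace :=
      (Complex.eq_re_of_ofReal_le (r := 0) (by simpa using hX.trace_nonneg)).symm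
    have ht0 : 0 ≤ X.trace.re := (Complex.nonneg_iff.1 hX.trace_nonneg).1
    set t := X.trace.re with ht
    -- The bound on density matrices extends to positive semidefinite `X` by normalising; trace zero
    -- forces X = 0.
    rcases ht0.eq_or_lt with h0 | h0
    · have hX0 : X = 0 := hX.trace_eq_zero_iff.1 (by rw [← htr, ← h0]; simp)
      have h2 := trPow_smul (PosSemidef.zero (n := B) (R := ℂ)) le_rfl α
      rw [smul_zero, Real.zero_rpow (by linarith), zero_mul] at h2
      rw [hX0, map_zero, h2]
      exact mul_nonneg hV (Real.rpow_nonneg ht0 α)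
    · have htC : (t : ℂ) ≠ 0 := by exact_mod_cast h0.ne'
      have hY : ((((t⁻¹ : ℝ) : ℂ) • X).PosSemidef) :=
        hX.smul (by simpa using ht0)
      have hYtr : (((t⁻¹ : ℝ) : ℂ) • X).trace = 1 := by
        rw [trace_smul, ← htr, smul_eq_mul]
        push_cast
        exact inv_mul_cancel₀ htC
      have hXY : X = (t : ℂ) • (((t⁻¹ : ℝ) : ℂ) • X) := by
        rw [smul_smul]
        push_cast
        rw [mul_inv_cancel₀ htC, one_smul]
      have h2 := h ⟨_, hY, hYtr⟩
      rw [hXY, map_smul, trPow_smul (hN'.posSemidef hY) ht0, mul_comm]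
      exact mul_le_mul_of_nonneg_right h2 (Real.rpow_nonneg ht0 α)

end TensorMatrix

/-! ### From the single-copy Holevo information to n copies -/

section Main

variable {A B : Type*} [Fintype A] [DecidableEq A] [Fintype B] [DecidableEq B]

/-- Minimax with regularisation: each ensemble's own σ is mixed with the maximally mixed state,
giving a point of the compact set where the averaged bound holds up to (1-ε)^(1-α). -/
theorem exists_state_of_ensemble_bound {N : Matrix A A ℂ →ₗ[ℂ] Matrix B B ℂ}
    (hN : IsEntanglementBreakingChannel N) {α : ℝ} (hα : 1 < α) [Nonempty (DensityMatrix A)]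
    {v : ℝ} (hv : 0 ≤ v)
    (h : ∀ E : Ensemble A, ∃ σ : DensityMatrix B,
      sandwichedQ α (cqState E.prob fun x => N (E.state x).1)
        (ptraceRight (cqState E.prob fun x => N (E.state x).1) ⊗ₖ σ.1) ≤ ENNReal.ofReal v)
    {ε : ℝ} (hε : 0 < ε) (hε1 : ε < 1) :
    ∃ σ : DensityMatrix B, σ.1.PosDef ∧
      ∀ ρ : DensityMatrix A, sandwichTr α (N ρ.1) σ.1 ≤ (1 - ε) ^ (1 - α) * v := by
  have hNtr : ∀ ρ : DensityMatrix A, (N ρ.1).trace = 1 := fun ρ => (hN.2 _).trans ρ.2.2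
  have hNpsd : ∀ ρ : DensityMatrix A, (N ρ.1).PosSemidef := fun ρ => hN.1.posSemidef ρ.2.1
  have hB : Nonempty B := by
    by_contra hB
    rw [not_nonempty_iff] at hB
    obtain ⟨ρ⟩ := ‹Nonempty (DensityMatrix A)›
    have := hNtr ρ
    simp [trace] at this
  have hcard : 0 < (Fintype.card B : ℝ) := by exact_mod_cast Fintype.card_pos
  -- This weight makes (1-ε)σ + δ·1 have trace one.
  set δ := ε / Fintype.card B with hδ
  have hδ0 : 0 < δ := div_pos hε hcard
  have hε' : 0 < 1 - ε := by linarith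
  obtain ⟨σ, hσ, hle⟩ := exists_state_forall_sandwichTr_le (T := DensityMatrix A) hα hδ0
    (ω := fun ρ => N ρ.1) hNpsd (v := (1 - ε) ^ (1 - α) * v) (fun k p t hp hp1 => by
      obtain ⟨σ, hσ⟩ := h ⟨k, p, hp, hp1, t⟩
      simp only [] at hσ
      have hsupp : supp (cqState p fun x => N (t x).1) ≤
          supp (ptraceRight (cqState p fun x => N (t x).1) ⊗ₖ σ.1) := by
        by_contra hns
        rw [sandwichedQ, if_neg hns] at hσ
        exact ENNReal.ofReal_ne_top (top_le_iff.1 hσ)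
      rw [sandwichedQ_cqState hα hp (fun x => hNpsd (t x)) (fun x => hNtr (t x)) σ.2.1 hsupp,
        ENNReal.ofReal_le_ofReal_iff hv] at hσ
      rw [supp_cqState_le p fun x => hNtr (t x)] at hsupp
      refine ⟨((1 - ε : ℝ) : ℂ) • σ.1 + (δ : ℂ) • (1 : Matrix B B ℂ), ⟨?_, ?_⟩, ?_⟩
      · rw [add_sub_cancel_right]
        exact σ.2.1.smul (by exact_mod_cast hε'.le)
      · rw [trace_add, trace_smul, trace_smul, σ.2.2, trace_one, smul_eq_mul, smul_eq_mul]
        have : (1 - ε) * 1 + δ * Fintype.card B = 1 := by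
          rw [hδ, div_mul_cancel₀ _ hcard.ne']
          ring
        exact_mod_cast this
      · refine le_trans ?_ (mul_le_mul_of_nonneg_left hσ (Real.rpow_nonneg hε'.le (1 - α)))
        rw [Finset.mul_sum]
        refine Finset.sum_le_sum fun x _ => ?_
        -- Finiteness of the quasi-entropy controls the support of an output only when its weight is
        -- nonzero.
        by_cases hx : p x = 0
        · simp [hx]
        · rw [mul_left_comm]
          exact mul_le_mul_of_nonneg_left
            (sandwichTr_mix_le hα (hNpsd (t x)) σ.2.1 (hsupp x hx) hε1 hδ0.le) (hp x))
  have hpd := boundedBelowStates_posDef hδ0 hσ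
  exact ⟨⟨σ, hpd.posSemidef, hσ.2⟩, hpd, hle⟩

/-- The witness is σ^{⊗n}; it is invertible, so the support condition is automatic. -/
theorem exists_sandwichedQ_tensorPower_le {N : Matrix A A ℂ →ₗ[ℂ] Matrix B B ℂ}
    (hN : IsEntanglementBreakingChannel N) {α : ℝ} (hα : 1 < α) {σ : DensityMatrix B}
    (hσ : σ.1.PosDef) {V : ℝ} (hV : 0 ≤ V)
    (h : ∀ ρ : DensityMatrix A, sandwichTr α (N ρ.1) σ.1 ≤ V) (n : ℕ) (E : Ensemble (Fin n → A)) :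
    ∃ σ' : DensityMatrix (Fin n → B),
      sandwichedQ α (cqState E.prob fun x => tensorPower N n (E.state x).1)
        (ptraceRight (cqState E.prob fun x => tensorPower N n (E.state x).1) ⊗ₖ σ'.1) ≤
          ENNReal.ofReal (V ^ n) := by
  have htr : ∀ x, (tensorPower N n (E.state x).1).trace = 1 := fun x =>
    (trace_tensorPower hN.2 n _).trans (E.state x).2.2
  have hpsd : ∀ ρ : DensityMatrix (Fin n → A), (tensorPower N n ρ.1).PosSemidef :=
    fun ρ => hN.1.tensorPower_posSemidef n ρ.2.1
  refine ⟨⟨tensorMat fun _ => σ.1, tensorMat_posSemidef n σ.2.1, ?_⟩, ?_⟩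
  · rw [trace_tensorMat, σ.2.2]
    simp
  · rw [sandwichedQ_cqState hα E.prob_nonneg (fun x => hpsd (E.state x)) htr
      (tensorMat_posSemidef n σ.2.1)]
    · refine ENNReal.ofReal_le_ofReal ?_
      calc _ ≤ ∑ x, E.prob x * V ^ n := Finset.sum_le_sum fun x _ =>
            mul_le_mul_of_nonneg_left
              (sandwichTr_tensorPower_le hN.1 hα σ.2.1 hV h n (E.state x)) (E.prob_nonneg x)
        _ = V ^ n := by rw [← Finset.sum_mul, E.prob_sum, one_mul]
    · rw [supp_cqState_le _ htr]
      intro x _ v hv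
      rw [tensorMat_mulVec_eq_zero n hσ.isUnit hv, mulVec_zero]

theorem coe_mul_lt_coe_mul {c : ℝ} (hc : 0 < c) {x y : EReal} :
    (c : EReal) * x < c * y ↔ x < y := by
  have h : ∀ {x y : EReal}, x ≤ y → (c : EReal) * x ≤ c * y := fun hxy =>
    mul_le_mul_of_nonneg_left hxy (by exact_mod_cast hc.le)
  have h' : ∀ {x y : EReal}, (c : EReal) * x ≤ c * y → x ≤ y := by
    intro x y hxy
    have h1 := mul_le_mul_of_nonneg_left hxy
      (show (0 : EReal) ≤ ((c⁻¹ : ℝ) : EReal) by exact_mod_cast (inv_pos.2 hc).le)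
    rwa [← mul_assoc, ← mul_assoc, ← EReal.coe_mul, inv_mul_cancel₀ hc.ne', EReal.coe_one, one_mul,
      one_mul] at h1
  exact ⟨fun hxy => lt_of_not_ge fun hn => hxy.not_ge (h hn),
    fun hxy => lt_of_not_ge fun hn => hxy.not_ge (h' hn)⟩

/-- Allows comparisons of extended reals to be made between their exponentials in `ENNReal`, with
infinite values included. -/
theorem exists_eq_coe_mul_log {c : ℝ} (hc : 0 < c) (x : EReal) :
    ∃ w : ENNReal, x = (c : EReal) * ENNReal.log w := by
  obtain ⟨w, hw⟩ := ENNReal.logOrderIso.surjective (((c⁻¹ : ℝ) : EReal) * x)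
  refine ⟨w, ?_⟩
  have hw' : ENNReal.log w = ((c⁻¹ : ℝ) : EReal) * x := hw
  rw [hw', ← mul_assoc, ← EReal.coe_mul, mul_inv_cancel₀ hc.ne', EReal.coe_one, one_mul]

theorem ensembleHolevo_tensorPower_le {N : Matrix A A ℂ →ₗ[ℂ] Matrix B B ℂ}
    (hN : IsEntanglementBreakingChannel N) {α : ℝ} (hα : 1 < α) [Nonempty (DensityMatrix A)]
    {w v : ENNReal} (hwv : w < v) (hv : v ≠ ⊤)
    (hw : holevoInfo α N ≤ ((1 / ((α - 1) * Real.log 2) : ℝ) : EReal) * ENNReal.log w)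
    (n : ℕ) (E : Ensemble (Fin n → A)) :
    ensembleHolevo α E.prob (fun x => tensorPower N n (E.state x).1) ≤
      ((1 / ((α - 1) * Real.log 2) : ℝ) : EReal) * ENNReal.log (v ^ n) := by
  set c := 1 / ((α - 1) * Real.log 2) with hc
  have hc0 : 0 < c := one_div_pos.2 (mul_pos (by linarith) (Real.log_pos (by norm_num)))
  -- The gap from `w` to `v` is spent twice: up to `u` because the infimum over σ need not be
  -- attained, and from `u` to `v` on the regularisation.
  obtain ⟨u, hwu, huv⟩ := exists_between hwv
  have hu : u ≠ ⊤ := (huv.trans_le le_top).ne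
  have hu0 : 0 < u.toReal := ENNReal.toReal_pos (bot_le.trans_lt hwu).ne' hu
  have huv' : u.toReal < v.toReal := (ENNReal.toReal_lt_toReal hu hv).2 huv
  have hv0 : 0 < v.toReal := hu0.trans huv'
  have hα1 : 0 < α - 1 := by linarith
  -- With ε = 1 - q the regularisation factor q^(1-α) turns `u` into exactly `v`.
  set q := (u.toReal / v.toReal) ^ (1 / (α - 1)) with hq
  have hr0 : 0 < u.toReal / v.toReal := div_pos hu0 hv0
  have hq0 : 0 < q := Real.rpow_pos_of_pos hr0 _
  have hq1 : q < 1 := Real.rpow_lt_one hr0.le ((div_lt_one hv0).2 huv') (by positivity)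
  have hqv : q ^ (1 - α) * u.toReal = v.toReal := by
    have h1 : 1 / (α - 1) * (1 - α) = -1 := by
      field_simp
      ring
    rw [hq, ← Real.rpow_mul hr0.le, h1, Real.rpow_neg_one, inv_div, div_mul_cancel₀ _ hu0.ne']
  obtain ⟨σ, hσ, hσle⟩ := exists_state_of_ensemble_bound hN hα (v := u.toReal) hu0.le (fun E => by
    have h1 : ensembleHolevo α E.prob (fun x => N (E.state x).1) < (c : EReal) * ENNReal.log u :=
      ((le_iSup (fun E : Ensemble A => ensembleHolevo α E.prob fun x => N (E.state x).1) E).trans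
        hw).trans_lt ((coe_mul_lt_coe_mul hc0).2 (ENNReal.log_strictMono hwu))
    obtain ⟨σ, hσ⟩ := iInf_lt_iff.1 h1
    refine ⟨σ, ?_⟩
    rw [ENNReal.ofReal_toReal hu]
    exact (ENNReal.log_lt_log_iff.1 ((coe_mul_lt_coe_mul hc0).1 hσ)).le)
    (ε := 1 - q) (by linarith) (by linarith)
  rw [sub_sub_cancel, hqv] at hσle
  obtain ⟨σ', hσ'⟩ := exists_sandwichedQ_tensorPower_le hN hα hσ hv0.le hσle n E
  rw [ENNReal.ofReal_pow hv0.le, ENNReal.ofReal_toReal hv] at hσ'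
  refine (iInf_le _ σ').trans ?_
  exact mul_le_mul_of_nonneg_left (ENNReal.log_monotone hσ') (by exact_mod_cast hc0.le)

end Main

end QChannel

theorem mainTheorem7 {A B : Type*} [Fintype A] [DecidableEq A] [Fintype B] [DecidableEq B]
    (N : Matrix A A ℂ →ₗ[ℂ] Matrix B B ℂ) (hN : QChannel.IsEntanglementBreakingChannel N)
    (α : ℝ) (hα : α ∈ Set.Ioc (1 : ℝ) 2) (n : ℕ) (hn : 0 < n) :
    QChannel.holevoInfo α (QChannel.tensorPower N n) ≤ (n : EReal) * QChannel.holevoInfo α N := by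
  have hα1 : 1 < α := hα.1
  set c := 1 / ((α - 1) * Real.log 2) with hc
  have hc0 : 0 < c := one_div_pos.2 (mul_pos (by linarith) (Real.log_pos (by norm_num)))
  obtain ⟨w, hw⟩ := QChannel.exists_eq_coe_mul_log hc0 (QChannel.holevoInfo α N)
  refine iSup_le fun E => ?_
  -- If `A` is empty then, as n > 0, so is `Fin n → A`; no density matrix exists there, and the
  -- empty probabilities cannot sum to one.
  have hA : Nonempty A := by
    by_contra hA
    rw [not_nonempty_iff] at hA
    have hF : IsEmpty (Fin n → A) := ⟨fun f => hA.false (f ⟨0, hn⟩)⟩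
    have hs := E.prob_sum
    have hE : IsEmpty (Fin E.size) := ⟨fun x => by
      have := (E.state x).2.2
      simp [Matrix.trace] at this⟩
    simp at hs
  obtain ⟨a⟩ := hA
  have : Nonempty (QChannel.DensityMatrix A) :=
    ⟨⟨Matrix.diagonal (Pi.single a 1), Matrix.PosSemidef.diagonal fun i => by
      by_cases h : i = a
      · subst h; simp
      · simp [h], by simp [Matrix.trace_diagonal]⟩⟩
  obtain ⟨z, hz⟩ := QChannel.exists_eq_coe_mul_log hc0
    (QChannel.ensembleHolevo α E.prob fun x => QChannel.tensorPower N n (E.state x).1)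
  -- The bound is known with every finite v > w in place of `w`; continuity of v ↦ v^n lets `v`
  -- decrease to `w`.
  have hzw : z ≤ w ^ n := by
    by_cases hwt : w = ⊤
    · rw [hwt, ENNReal.top_pow hn.ne']
      exact le_top
    have hne : (nhdsWithin w (Set.Ioi w)).NeBot :=
      nhdsGT_neBot_of_exists_gt ⟨⊤, lt_top_iff_ne_top.2 hwt⟩
    have hlim : Filter.Tendsto (fun v : ENNReal => v ^ n) (nhdsWithin w (Set.Ioi w))
        (nhds (w ^ n)) := ((ENNReal.continuous_pow n).tendsto w).mono_left nhdsWithin_le_nhds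
    refine ge_of_tendsto hlim ?_
    filter_upwards [self_mem_nhdsWithin] with v hv
    by_cases hvt : v = ⊤
    · rw [hvt, ENNReal.top_pow hn.ne']
      exact le_top
    have h := QChannel.ensembleHolevo_tensorPower_le hN hα1 hv hvt hw.le n E
    rw [hz] at h
    by_contra hlt
    exact h.not_gt ((QChannel.coe_mul_lt_coe_mul hc0).2
      (ENNReal.log_strictMono (lt_of_not_ge hlt)))
  rw [hz, hw, mul_left_comm, ← ENNReal.log_pow]
  exact mul_le_mul_of_nonneg_left (ENNReal.log_monotone hzw) (by exact_mod_cast hc0.le)
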